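/- \textbf{Setting.} Let $\varphi:\mathbb R_+\to[0,\infty]$ be convex and lower semicontinuous with $\varphi^{-1}(\{0\})=\{1\}$; put $\varphi'_\infty=\lim_{r\to\infty}\varphi(r)/r$, $\psi(r)=r\,\varphi(1/r)$ for $r>0$ and $\psi(0)=\varphi'_\infty$. Let $\lambda:\mathbb R_+\to[0,\infty]$ satisfy $\lambda^{-1}(\{0\})=\{0\}$, let $\Delta$ be a distance on the set $\mathbb R_+$ such that $(t,u)\mapsto\lambda(\Delta(t,u))$ is lower semicontinuous for the usual topology (for instance, $\lambda$ lower semicontinuous and $\Delta(t,u)=|t-u|$), and let $p>0$, $q>0$. For $c\in[0,\infty]$ and $r,s\ge 0$ let $$H_c(r,s)=\inf_{\theta\ge 0}\ \theta\big(c+\psi(\tfrac r\theta)+\psi(\tfrac s\theta)\big),$$ where the expression is read as $\varphi(0)(r+s)$ at $\theta=0$. For a nonempty set $X$ let $\mathfrak C[X]=(X\times\mathbb R_+)/(X\times\{0\})$ be the cone over $X$, with points $[x,r]$. The cone cost $\mathfrak D$ on $\mathfrak C[\mathbb R_+]$ is defined by $$\mathfrak D([t,r],[u,s])^q=H_{\lambda(\Delta(t,u))}(r^p,s^p),$$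 where, if the right-hand side depends on the choice of representatives (which can happen only if $r=0$ or $s=0$), the infimum over representatives is taken. An mm-space $\mathcal X=(X,d_X,\mu)$ is a nonempty complete separable metric space with a finite positive Borel measure. Two mm-spaces $(X,d_X,\mu)$, $(Y,d_Y,\nu)$ are \emph{isometric} if there is a distance-preserving bijection of $\operatorname{supp}\mu$ onto $\operatorname{supp}\nu$ that pushes $\mu$ forward to $\nu$. Let $\mathcal U_p(\mu,\nu)$ be the set of finite positive measures $\alpha$ on $\mathfrak C[X]\times\mathfrak C[Y]$, with marginals $\alpha_1,\alpha_2$, such that $\int_{\mathbb R_+} r^p\,d\alpha_1(\cdot,r)=\mu$ and $\int_{\mathbb R_+} s^p\,d\alpha_2(\cdot,s)=\nu$, and let $$\mathrm{CGW}(\mathcal X,\mathcal Y)=\inf_{\alpha\in\mathcal U_p(\mu,\nu)}\iint \mathfrak D\big([d_X(x,x'),rr'],[d_Y(y,y'),ss']\big)^q\,d\alpha([x,r],[y,s])\,d\alpha([x',r'],[y',s'])\ \in[0,\infty].$$ \textbf{Theorem.} $\mathrm{CGW}$ is nonnegative and symmetric, and $\mathrm{CGW}(\mathcal X,\mathcal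 Y)=0$ if and only if $\mathcal X$ and $\mathcal Y$ are isometric. If moreover $q\ge 1$ and $\mathfrak D$ is a (finite) distance on $\mathfrak C[\mathbb R_+]$, then $\mathrm{CGW}$ is finite and $\mathrm{CGW}^{1/q}$ is a distance on the set of mm-spaces up to isometry: it induces a metric on the set of isometry classes. -/

import Mathlib

open MeasureTheory Filter Set
open scoped NNReal ENNReal Topology

universe u

noncomputable section

namespace ConicGW

/-! ### Entropies and the perspective function -/

/-- Entropy functions `φ : ℝ₊ → [0, ∞]`: convex, lower semicontinuous, with `φ⁻¹({0}) = {1}`. -/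
structure IsEntropy (φ : ℝ≥0 → ℝ≥0∞) : Prop where
  convex : ConvexOn ℝ≥0 univ φ
  lsc : LowerSemicontinuous φ
  eq_zero_iff : ∀ x, φ x = 0 ↔ x = 1

/-- The recession constant `φ'_∞ = lim_{r → ∞} φ(r) / r` (the limit exists for an entropy). -/
def recession (φ : ℝ≥0 → ℝ≥0∞) : ℝ≥0∞ :=
  limsup (fun r : ℝ≥0 => φ r / (r : ℝ≥0∞)) atTop

/-- The reverse entropy `ψ(r) = r φ(1 / r)`, `ψ(0) = φ'_∞`. -/
def reverseEntropy (φ : ℝ≥0 → ℝ≥0∞) (r : ℝ≥0) : ℝ≥0∞ :=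
  if r = 0 then recession φ else (r : ℝ≥0∞) * φ (1 / r)

/-- The expression `θ (c + ψ(r / θ) + ψ(s / θ))`. At `θ = 0` it is read as
`ψ'_∞ (r + s) = φ(0) (r + s)`, for every `c ∈ [0, ∞]`. -/
def perspective (φ : ℝ≥0 → ℝ≥0∞) (c : ℝ≥0∞) (r s θ : ℝ≥0) : ℝ≥0∞ :=
  if θ = 0 then φ 0 * ((r : ℝ≥0∞) + s)
  else (θ : ℝ≥0∞) * (c + reverseEntropy φ (r / θ) + reverseEntropy φ (s / θ))

/-- `H_c(r, s) = inf_{θ ≥ 0} θ (c + ψ(r / θ) + ψ(s / θ))`. -/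
def homogCost (φ : ℝ≥0 → ℝ≥0∞) (c : ℝ≥0∞) (r s : ℝ≥0) : ℝ≥0∞ :=
  ⨅ θ : ℝ≥0, perspective φ c r s θ

/-! ### The cone over a set -/

/-- The relation on `X × ℝ₊` that collapses `X × {0}` to a point. -/
def coneSetoid (X : Type*) : Setoid (X × ℝ≥0) where
  r a b := a = b ∨ (a.2 = 0 ∧ b.2 = 0)
  iseqv :=
    { refl := fun _ => Or.inl rfl
      symm := by
        rintro a b (h | ⟨h, h'⟩)
        · exact Or.inl h.symm
        · exact Or.inr ⟨h', h⟩
      trans := by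
        rintro a b c (rfl | ⟨h, h'⟩) (rfl | ⟨k, k'⟩)
        · exact Or.inl rfl
        · exact Or.inr ⟨k, k'⟩
        · exact Or.inr ⟨h, h'⟩
        · exact Or.inr ⟨h, k'⟩ }

/-- The cone `Co[X] = (X × ℝ₊) / (X × {0})`. -/
def Cone (X : Type*) : Type _ := Quotient (coneSetoid X)

/-- The class `[x, r]`. -/
def Cone.mk {X : Type*} (x : X) (r : ℝ≥0) : Cone X := Quotient.mk (coneSetoid X) (x, r)

/-- The radial coordinate `[x, r] ↦ r`. -/
def Cone.radius {X : Type*} : Cone X → ℝ≥0 :=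
  Quotient.lift (fun a : X × ℝ≥0 => a.2) (by
    rintro a b (rfl | ⟨h, h'⟩)
    · rfl
    · exact h.trans h'.symm)

/-- The quotient `σ`-algebra. Over a separable metric space with its Borel sets, it is the Borel
`σ`-algebra of the cone: the apex is a measurable point, and off the apex one has the Borel sets
of `X × (0, ∞)`. -/
instance Cone.instMeasurableSpace (X : Type*) [MeasurableSpace X] : MeasurableSpace (Cone X) :=
  inferInstanceAs (MeasurableSpace (Quotient (coneSetoid X)))

/-- The map `([x, r], [x', r']) ↦ [d(x, x'), r r']` from `Co[X] × Co[X]` to `Co[ℝ₊]`. -/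
def Cone.pair {X : Type*} [MetricSpace X] : Cone X → Cone X → Cone ℝ≥0 :=
  Quotient.lift₂ (fun a b : X × ℝ≥0 => Cone.mk (nndist a.1 b.1) (a.2 * b.2)) (by
    rintro a b a' b' (rfl | ⟨h, h'⟩) (rfl | ⟨k, k'⟩)
    · rfl
    all_goals exact Quotient.sound (Or.inr (by simp [*])))

/-! ### The cone cost on `Co[ℝ₊]` -/

/-- `D` is a distance on `T` (with values in `[0, ∞)`). -/
structure IsDistance {T : Type*} (D : T → T → ℝ≥0∞) : Prop where
  ne_top : ∀ a b, D a b ≠ ∞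
  eq_zero_iff : ∀ a b, D a b = 0 ↔ a = b
  symm : ∀ a b, D a b = D b a
  triangle : ∀ a b c, D a c ≤ D a b + D b c

/-- The cone cost `𝔇` on `Co[ℝ₊]`, given by `𝔇([t, r], [u, s])^q = H_{λ(Δ(t, u))}(r^p, s^p)`.
For some entropies the right-hand side at the apex depends on the representative `(t, 0)`; the
infimum over representatives is taken. It has no effect if `r, s > 0`
(`coneDist_mk_rpow_of_pos`), and none at all if the formula is compatible with the quotient
(`coneDist_mk_rpow`). -/
def coneDist (φ lam : ℝ≥0 → ℝ≥0∞) (Δ : ℝ≥0 → ℝ≥0 → ℝ≥0) (p q : ℝ) (a b : Cone ℝ≥0) : ℝ≥0∞ :=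
  (⨅ (t : ℝ≥0) (r : ℝ≥0) (_ : Cone.mk t r = a) (u : ℝ≥0) (s : ℝ≥0) (_ : Cone.mk u s = b),
    homogCost φ (lam (Δ t u)) (r ^ p) (s ^ p)) ^ (1 / q)

theorem Cone.mk_eq_mk {X : Type*} {x y : X} {r s : ℝ≥0} :
    Cone.mk x r = Cone.mk y s ↔ (x = y ∧ r = s) ∨ (r = 0 ∧ s = 0) := by
  constructor
  · intro h
    rcases Quotient.exact h with h | h
    · exact Or.inl (by simpa using h)
    · exact Or.inr h
  · rintro (⟨rfl, rfl⟩ | h)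
    · rfl
    · exact Quotient.sound (Or.inr h)

theorem coneDist_mk_rpow (φ lam : ℝ≥0 → ℝ≥0∞) (Δ : ℝ≥0 → ℝ≥0 → ℝ≥0) (p q : ℝ) (hq : 0 < q)
    (h : ∀ t t' r u u' s : ℝ≥0, (t = t' ∨ r = 0) → (u = u' ∨ s = 0) →
      homogCost φ (lam (Δ t u)) (r ^ p) (s ^ p) = homogCost φ (lam (Δ t' u')) (r ^ p) (s ^ p))
    (t r u s : ℝ≥0) :
    coneDist φ lam Δ p q (Cone.mk t r) (Cone.mk u s) ^ q =
      homogCost φ (lam (Δ t u)) (r ^ p) (s ^ p) := by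
  unfold coneDist
  rw [← ENNReal.rpow_mul, one_div, inv_mul_cancel₀ hq.ne', ENNReal.rpow_one]
  refine le_antisymm ?_ ?_
  · exact iInf_le_of_le t <| iInf_le_of_le r <| iInf_le_of_le rfl <| iInf_le_of_le u <|
      iInf_le_of_le s <| iInf_le_of_le rfl le_rfl
  · refine le_iInf fun t' => le_iInf fun r' => le_iInf fun h1 => le_iInf fun u' =>
      le_iInf fun s' => le_iInf fun h2 => ?_
    rw [Cone.mk_eq_mk] at h1 h2
    have e1 : r' = r := by rcases h1 with h1 | h1 <;> simp [h1]
    have e2 : s' = s := by rcases h2 with h2 | h2 <;> simp [h2]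
    subst e1 e2
    exact (h t t' r' u u' s' (by tauto) (by tauto)).le

theorem coneDist_mk_rpow_of_pos (φ lam : ℝ≥0 → ℝ≥0∞) (Δ : ℝ≥0 → ℝ≥0 → ℝ≥0) (p q : ℝ)
    (hq : 0 < q) (t r u s : ℝ≥0) (hr : 0 < r) (hs : 0 < s) :
    coneDist φ lam Δ p q (Cone.mk t r) (Cone.mk u s) ^ q =
      homogCost φ (lam (Δ t u)) (r ^ p) (s ^ p) := by
  unfold coneDist
  rw [← ENNReal.rpow_mul, one_div, inv_mul_cancel₀ hq.ne', ENNReal.rpow_one]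
  refine le_antisymm ?_ ?_
  · exact iInf_le_of_le t <| iInf_le_of_le r <| iInf_le_of_le rfl <| iInf_le_of_le u <|
      iInf_le_of_le s <| iInf_le_of_le rfl le_rfl
  · refine le_iInf fun t' => le_iInf fun r' => le_iInf fun h1 => le_iInf fun u' =>
      le_iInf fun s' => le_iInf fun h2 => ?_
    rw [Cone.mk_eq_mk] at h1 h2
    obtain ⟨rfl, rfl⟩ : t' = t ∧ r' = r := h1.resolve_right fun k => hr.ne' k.2
    obtain ⟨rfl, rfl⟩ : u' = u ∧ s' = s := h2.resolve_right fun k => hs.ne' k.2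
    exact le_rfl

/-! ### Metric measure spaces -/

/-- A metric measure space: a nonempty complete separable metric space with a finite positive
Borel measure. -/
structure MMSpace : Type (u + 1) where
  carrier : Type u
  [metric : MetricSpace carrier]
  [complete : CompleteSpace carrier]
  [separable : TopologicalSpace.SeparableSpace carrier]
  [nonempty : Nonempty carrier]
  [measurable : MeasurableSpace carrier]
  [borel : BorelSpace carrier]
  meas : Measure carrier
  [finite : IsFiniteMeasure meas]

attribute [instance] MMSpace.metric MMSpace.complete MMSpace.separable MMSpace.nonempty
  MMSpace.measurable MMSpace.borel MMSpace.finite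

/-- `𝒳 ∼ 𝒴`: there is an isometric bijection between the supports of the measures that carries
the one measure to the other. -/
def MMSpace.Isometric (X Y : MMSpace) : Prop :=
  ∃ ψ : X.meas.support ≃ᵢ Y.meas.support,
    (X.meas.comap (Subtype.val : X.meas.support → X.carrier)).map ψ =
      Y.meas.comap (Subtype.val : Y.meas.support → Y.carrier)

theorem MMSpace.isometric_equivalence : Equivalence MMSpace.Isometric.{u} where
  refl X := ⟨IsometryEquiv.refl _, Measure.map_id⟩
  symm := by
    rintro X Y ⟨ψ, h⟩
    refine ⟨ψ.symm, ?_⟩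
    rw [← h, Measure.map_map ψ.symm.continuous.measurable ψ.continuous.measurable]
    have : (ψ.symm : Y.meas.support → X.meas.support) ∘ ψ = id := by
      funext x
      exact ψ.symm_apply_apply x
    rw [this, Measure.map_id]
  trans := by
    rintro X Y Z ⟨ψ, h⟩ ⟨χ, k⟩
    refine ⟨ψ.trans χ, ?_⟩
    rw [← k, ← h, Measure.map_map χ.continuous.measurable ψ.continuous.measurable]
    rfl

/-- The equivalence relation "isometric" on mm-spaces. -/
def MMSpace.isometricSetoid : Setoid MMSpace.{u} :=
  ⟨MMSpace.Isometric, MMSpace.isometric_equivalence⟩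

/-! ### The conic Gromov-Wasserstein divergence -/

/-- The constraint `∫_{ℝ₊} r^p dβ(·, r) = μ` on a measure `β` on `Co[X]`. The apex belongs to the
image below when `A` is nonempty, but has weight `0^p = 0`. -/
def HasConicMarginal {X : Type*} [MeasurableSpace X] (p : ℝ) (β : Measure (Cone X))
    (μ : Measure X) : Prop :=
  ∀ A : Set X, MeasurableSet A →
    ∫⁻ c in (fun a : X × ℝ≥0 => Cone.mk a.1 a.2) '' (A ×ˢ univ), ((c.radius ^ p : ℝ≥0) : ℝ≥0∞) ∂β
      = μ A

/-- The set `𝒰_p(μ, ν)` of finite positive measures on `Co[X] × Co[Y]` with conic marginals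
`μ` and `ν`. -/
def conicPlans (p : ℝ) (X Y : MMSpace.{u}) : Set (Measure (Cone X.carrier × Cone Y.carrier)) :=
  {α | IsFiniteMeasure α ∧ HasConicMarginal p α.fst X.meas ∧ HasConicMarginal p α.snd Y.meas}

/-- `ℋ(α) = ∫∫ 𝔇([d_X(x, x'), r r'], [d_Y(y, y'), s s'])^q dα([x, r], [y, s]) dα([x', r'], [y', s'])`. -/
def conicFunctional (φ lam : ℝ≥0 → ℝ≥0∞) (Δ : ℝ≥0 → ℝ≥0 → ℝ≥0) (p q : ℝ) {X Y : MMSpace.{u}}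
    (α : Measure (Cone X.carrier × Cone Y.carrier)) : ℝ≥0∞ :=
  ∫⁻ w, ∫⁻ z, coneDist φ lam Δ p q (Cone.pair w.1 z.1) (Cone.pair w.2 z.2) ^ q ∂α ∂α

/-- `CGW(𝒳, 𝒴) = inf_{α ∈ 𝒰_p(μ, ν)} ℋ(α)`. -/
def CGW (φ lam : ℝ≥0 → ℝ≥0∞) (Δ : ℝ≥0 → ℝ≥0 → ℝ≥0) (p q : ℝ) (X Y : MMSpace.{u}) : ℝ≥0∞ :=
  ⨅ α ∈ conicPlans p X Y, conicFunctional φ lam Δ p q α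

end ConicGW

end

noncomputable section

namespace ConicGW

/-! ### Entropies and their perspective -/

/-! The infimum over `θ` defining `H_c(r, s)` may be taken over a compact set and is attained, so
`H_c(r, s) = 0` forces `θ = r = s` and `θ c = 0`. Hence the integrand is, in the weights `a = r ^
p`, a lower semicontinuous `1`-homogeneous kernel that vanishes only if the products of weights
agree and, unless they are zero, the distances agree too. `IsConeKernel` collects these properties,
and `CGW_eq` replaces cones by products, the base point at weight zero being irrelevant.

Homogeneity allows a plan to be rescaled pointwise, mass against weights, without changing
constraints or energy (`IsLiftedPlan.reweight`). Two normalizations are used: `a + b = 1`, which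
bounds the mass, and `b ∈ {0, 1}`, which fixes the marginal over `Y` up to an atom at the apex.

If CGW vanishes, take plans with `a + b = 1` and energy tending to zero. Such plans need not be
tight, as `μ` does not control the place where `a` is small; but with density `2 min(a, b)` they are
dominated by `2 μ` and `2 ν`. Small energy makes the discarded mass negligible, so a weak limit
keeps the full mass `μ(X) + ν(Y)` and has marginals exactly `2 μ` and `2 ν`. By lower semicontinuity
the cost is zero on pairs of points of its support: the diagonal gives `a = b = 1/2`, the other
pairs give equal distances (`IsConeKernel.exists_isometric_coupling`). Both projections are then
isometries onto the supports of `μ` and `ν`.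

For the triangle inequality, the second normalization makes two plans gluable over `Y`
(`exists_glue`), and Minkowski's inequality in `L^q` of the squared gluing finishes
(`IsLiftedPlan.exists_comp`). -/

theorem IsEntropy.apply_one {φ : ℝ≥0 → ℝ≥0∞} (hφ : IsEntropy φ) : φ 1 = 0 :=
  (hφ.eq_zero_iff 1).2 rfl

/-- `x ↦ φ x / x` is monotone on `[1, ∞)`. -/
theorem IsEntropy.mul_le_mul {φ : ℝ≥0 → ℝ≥0∞} (hφ : IsEntropy φ) {x y : ℝ≥0} (hx : 1 ≤ x)
    (hxy : x ≤ y) : φ x * y ≤ x * φ y := by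
  rcases (hx.trans hxy).eq_or_lt with rfl | hy
  · obtain rfl := le_antisymm hxy hx
    simp [hφ.apply_one]
  have hy0 : 0 < y - 1 := tsub_pos_of_lt hy
  -- With this `t`, `x` is a convex combination of `1` and `y`. As `φ 1 = 0`, convexity gives `φ x ≤
  -- t * φ y`, and `t * y ≤ x` finishes.
  set t : ℝ≥0 := (x - 1) / (y - 1) with ht
  have ht1 : t ≤ 1 := div_le_one_of_le₀ (tsub_le_tsub_right hxy 1) (zero_le)
  have hty : t * (y - 1) = x - 1 := div_mul_cancel₀ _ hy0.ne'
  have hcomb : (1 - t) • (1 : ℝ≥0) + t • y = x := by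
    have h1 : y = (y - 1) + 1 := (tsub_add_cancel_of_le hy.le).symm
    have h2 : x = (x - 1) + 1 := (tsub_add_cancel_of_le hx).symm
    rw [smul_eq_mul, smul_eq_mul, mul_one, h1, mul_add, hty, mul_one]
    nth_rewrite 2 [h2]
    rw [add_comm (x - 1) t, ← add_assoc, tsub_add_cancel_of_le ht1, add_comm]
  have hconv := hφ.convex.2 (mem_univ 1) (mem_univ y) (zero_le (a := 1 - t)) (zero_le (a := t))
    (tsub_add_cancel_of_le ht1)
  rw [hcomb, hφ.apply_one, smul_zero, zero_add] at hconv
  have hty' : t * y ≤ x := by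
    have h1 : y = (y - 1) + 1 := (tsub_add_cancel_of_le hy.le).symm
    have h2 : x = (x - 1) + 1 := (tsub_add_cancel_of_le hx).symm
    rw [h1, mul_add, hty, mul_one, h2]
    simpa using add_le_add_right ht1 (x - 1)
  calc φ x * y ≤ (t • φ y) * y := by gcongr
    _ = ((t * y : ℝ≥0) : ℝ≥0∞) * φ y := by
      rw [ENNReal.smul_def, smul_eq_mul, ENNReal.coe_mul]; ring
    _ ≤ x * φ y := by gcongr

theorem IsEntropy.div_le_div {φ : ℝ≥0 → ℝ≥0∞} (hφ : IsEntropy φ) {x y : ℝ≥0} (hx : 1 ≤ x)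
    (hxy : x ≤ y) : φ x / x ≤ φ y / y := by
  have hx0 : (x : ℝ≥0∞) ≠ 0 := by simpa using (zero_lt_one.trans_le hx).ne'
  have hy0 : (y : ℝ≥0∞) ≠ 0 := by simpa using (zero_lt_one.trans_le (hx.trans hxy)).ne'
  rw [ENNReal.div_le_iff hx0 ENNReal.coe_ne_top, ENNReal.div_eq_inv_mul, mul_assoc,
    mul_comm (φ y), ← ENNReal.div_eq_inv_mul, ENNReal.le_div_iff_mul_le (Or.inl hy0) (by simp)]
  exact hφ.mul_le_mul hx hxy

/-- The slope `φ x / x` increases on `[1, ∞)`, so each of its values there is below the limsup. -/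
theorem IsEntropy.le_mul_recession {φ : ℝ≥0 → ℝ≥0∞} (hφ : IsEntropy φ) {x : ℝ≥0} (hx : 1 ≤ x) :
    φ x ≤ x * recession φ := by
  have hx0 : (x : ℝ≥0∞) ≠ 0 := by simpa using (zero_lt_one.trans_le hx).ne'
  have : φ x / x ≤ recession φ :=
    le_limsup_of_frequently_le
      ((eventually_ge_atTop x).mono fun y hy => hφ.div_le_div hx hy).frequently
  rw [mul_comm]
  exact (ENNReal.div_le_iff hx0 ENNReal.coe_ne_top).1 this

theorem IsEntropy.recession_ne_zero {φ : ℝ≥0 → ℝ≥0∞} (hφ : IsEntropy φ) : recession φ ≠ 0 := by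
  intro h
  have := hφ.le_mul_recession (x := 2) (by norm_num)
  rw [h, mul_zero, nonpos_iff_eq_zero, hφ.eq_zero_iff] at this
  norm_num at this

theorem exists_mul_le_of_lt_recession {φ : ℝ≥0 → ℝ≥0∞} {C : ℝ≥0∞} (hC : C < recession φ) :
    ∃ x : ℝ≥0, 1 ≤ x ∧ C * x ≤ φ x := by
  have h := (frequently_lt_of_lt_limsup (by isBoundedDefault) hC).and_eventually
    (eventually_ge_atTop (1 : ℝ≥0))
  obtain ⟨x, hx, hx1⟩ := h.exists
  have hx0 : (x : ℝ≥0∞) ≠ 0 := by simpa using (zero_lt_one.trans_le hx1).ne'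
  exact ⟨x, hx1, (ENNReal.le_div_iff_mul_le (Or.inl hx0) (by simp)).1 hx.le⟩

/-- The perspective `(θ, r) ↦ r φ(θ / r)`, extended by `θ φ'_∞` to `r = 0`. -/
def persp (φ : ℝ≥0 → ℝ≥0∞) (θ r : ℝ≥0) : ℝ≥0∞ :=
  if r = 0 then θ * recession φ else r * φ (θ / r)

/-- The separate convention at `θ = 0` disappears: `persp φ 0 r = φ 0 * r` for every `r`, and `0 * c
= 0` even for `c = ∞`. -/
theorem perspective_eq (φ : ℝ≥0 → ℝ≥0∞) (c : ℝ≥0∞) (r s θ : ℝ≥0) :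
    perspective φ c r s θ = θ * c + persp φ θ r + persp φ θ s := by
  have h0 : ∀ r, persp φ 0 r = φ 0 * r := fun r => by
    by_cases hr : r = 0 <;> simp [persp, hr, mul_comm]
  have h1 : ∀ r, θ ≠ 0 → (θ : ℝ≥0∞) * reverseEntropy φ (r / θ) = persp φ θ r := fun r hθ => by
    by_cases hr : r = 0
    · simp [persp, reverseEntropy, hr]
    · have : θ * (r / θ) = r := mul_div_cancel₀ _ hθ
      rw [persp, reverseEntropy, if_neg hr, if_neg (div_ne_zero hr hθ), ← mul_assoc,
        ← ENNReal.coe_mul, this, one_div_div]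
  by_cases hθ : θ = 0
  · subst hθ
    simp [perspective, h0, mul_add]
  · rw [perspective, if_neg hθ, mul_add, mul_add, h1 r hθ, h1 s hθ]

theorem IsEntropy.persp_eq_zero_iff {φ : ℝ≥0 → ℝ≥0∞} (hφ : IsEntropy φ) {θ r : ℝ≥0} :
    persp φ θ r = 0 ↔ θ = r := by
  by_cases hr : r = 0
  · simp [persp, hr, hφ.recession_ne_zero]
  · simp [persp, hr, hφ.eq_zero_iff, div_eq_one_iff_eq hr]

theorem persp_mul (φ : ℝ≥0 → ℝ≥0∞) {k : ℝ≥0} (hk : k ≠ 0) (θ r : ℝ≥0) :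
    persp φ (k * θ) (k * r) = k * persp φ θ r := by
  by_cases hr : r = 0
  · simp [persp, hr, mul_assoc]
  · rw [persp, persp, if_neg hr, if_neg (mul_ne_zero hk hr), mul_div_mul_left _ _ hk,
      ENNReal.coe_mul, mul_assoc]

theorem IsEntropy.persp_mono {φ : ℝ≥0 → ℝ≥0∞} (hφ : IsEntropy φ) {θ θ' r : ℝ≥0} (hr : r ≤ θ)
    (hθ : θ ≤ θ') : persp φ θ r ≤ persp φ θ' r := by
  by_cases h0 : r = 0
  · simp only [persp, h0, if_true]; gcongr
  have h1 : 1 ≤ θ / r := (one_le_div (pos_of_ne_zero h0)).2 hr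
  have h2 : θ / r ≤ θ' / r := by gcongr
  have h3 := hφ.mul_le_mul h1 h2
  rw [persp, persp, if_neg h0, if_neg h0]
  gcongr
  have hpos : ((θ / r : ℝ≥0) : ℝ≥0∞) ≠ 0 := by simpa using (zero_lt_one.trans_le h1).ne'
  have h4 : φ (θ / r) * ((θ / r : ℝ≥0) : ℝ≥0∞) ≤ φ (θ' / r) * ((θ / r : ℝ≥0) : ℝ≥0∞) :=
    (mul_le_mul_right (ENNReal.coe_le_coe.2 h2) _).trans (h3.trans_eq (mul_comm _ _))
  exact (ENNReal.mul_le_mul_iff_left hpos ENNReal.coe_ne_top).1 h4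

theorem exists_lt_lt_of_lt_mul {a b y : ℝ≥0∞} (h : y < a * b) :
    ∃ a' < a, ∃ b' < b, y < a' * b' := by
  by_contra! H
  exact absurd (ENNReal.mul_le_of_forall_lt fun a' ha b' hb => H a' ha b' hb) (not_le.2 h)

/-- Multiplication on `ℝ≥0∞` is discontinuous at `(0, ∞)`, but still lower semicontinuous: a product
is the supremum of products of strictly smaller factors. -/
theorem LowerSemicontinuousAt.ennreal_mul {T : Type*} [TopologicalSpace T] {f g : T → ℝ≥0∞} {x : T}
    (hf : LowerSemicontinuousAt f x) (hg : LowerSemicontinuousAt g x) :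
    LowerSemicontinuousAt (fun z => f z * g z) x := by
  intro y hy
  obtain ⟨a, ha, b, hb, hab⟩ := exists_lt_lt_of_lt_mul hy
  filter_upwards [hf a ha, hg b hb] with z hz1 hz2
  exact hab.trans_le (mul_le_mul' hz1.le hz2.le)

/-- Only `r = 0` is delicate. For `b < φ'_∞` some `x ≥ 1` has `b x ≤ φ x`; since slopes increase, `r
φ(θ / r) ≥ b θ` as soon as `x r ≤ θ`. -/
theorem IsEntropy.lowerSemicontinuous_persp {φ : ℝ≥0 → ℝ≥0∞} (hφ : IsEntropy φ) :
    LowerSemicontinuous (fun z : ℝ≥0 × ℝ≥0 => persp φ z.1 z.2) := by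
  rintro ⟨θ, r⟩
  by_cases hr : r = 0
  · subst hr
    intro y hy
    simp only [persp, if_true] at hy
    obtain ⟨a, ha, b, hb, hab⟩ := exists_lt_lt_of_lt_mul hy
    obtain ⟨x, hx1, hx⟩ := exists_mul_le_of_lt_recession hb
    lift a to ℝ≥0 using ha.ne_top
    have ha : a < θ := by simpa using ha
    have e1 : ∀ᶠ z : ℝ≥0 × ℝ≥0 in 𝓝 (θ, 0), a < z.1 :=
      continuous_fst.continuousAt.eventually_const_lt ha
    have e2 : ∀ᶠ z : ℝ≥0 × ℝ≥0 in 𝓝 (θ, 0), x * z.2 < z.1 := by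
      have h1 : ContinuousAt (fun z : ℝ≥0 × ℝ≥0 => x * z.2) (θ, 0) := by fun_prop
      refine h1.eventually_lt continuous_fst.continuousAt ?_
      simpa using (zero_le).trans_lt ha
    filter_upwards [e1, e2] with z hz1 hz2
    by_cases hz : z.2 = 0
    · simp only [persp, hz, if_true]
      exact hab.trans_le (mul_le_mul' (by exact_mod_cast hz1.le) hb.le)
    · simp only [persp, hz, if_false]
      have hxz : x ≤ z.1 / z.2 := (le_div_iff₀ (pos_of_ne_zero hz)).2 hz2.le
      have hx0 : (x : ℝ≥0∞) ≠ 0 := by simpa using (zero_lt_one.trans_le hx1).ne'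
      have h1 : b * ((z.1 / z.2 : ℝ≥0) : ℝ≥0∞) ≤ φ (z.1 / z.2) := by
        refine (ENNReal.mul_le_mul_iff_right hx0 ENNReal.coe_ne_top).1 ?_
        refine le_trans ?_ (hφ.mul_le_mul hx1 hxz)
        rw [← mul_assoc, mul_comm (x : ℝ≥0∞)]
        gcongr
      refine hab.trans_le ?_
      calc (a : ℝ≥0∞) * b ≤ z.1 * b := by gcongr
        _ = z.2 * (b * ((z.1 / z.2 : ℝ≥0) : ℝ≥0∞)) := by
          rw [mul_left_comm, ← ENNReal.coe_mul, mul_div_cancel₀ _ hz, mul_comm]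
        _ ≤ _ := by gcongr
  · have h1 : LowerSemicontinuousAt (fun z : ℝ≥0 × ℝ≥0 => (z.2 : ℝ≥0∞) * φ (z.1 / z.2)) (θ, r) := by
      refine LowerSemicontinuousAt.ennreal_mul ?_ ?_
      · exact (ENNReal.continuous_coe.comp continuous_snd).lowerSemicontinuous _
      · have hc : ContinuousAt (fun z : ℝ≥0 × ℝ≥0 => z.1 / z.2) (θ, r) :=
          continuousAt_fst.div₀ continuousAt_snd hr
        intro y hy
        exact hc.eventually (hφ.lsc _ y hy)
    intro y hy
    have hne : ∀ᶠ z : ℝ≥0 × ℝ≥0 in 𝓝 (θ, r), z.2 ≠ 0 := continuousAt_snd.eventually_ne hr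
    simp only [persp, hr, if_false] at hy
    filter_upwards [h1 y hy, hne] with z hz1 hz2
    simpa only [persp, hz2, if_false] using hz1

/-! ### The homogeneous cost -/

theorem homogCost_eq (φ : ℝ≥0 → ℝ≥0∞) (c : ℝ≥0∞) (r s : ℝ≥0) :
    homogCost φ c r s = ⨅ θ : ℝ≥0, (θ * c + persp φ θ r + persp φ θ s) := by
  simp only [homogCost, perspective_eq]

theorem homogCost_mono (φ : ℝ≥0 → ℝ≥0∞) {c c' : ℝ≥0∞} (h : c ≤ c') (r s : ℝ≥0) :
    homogCost φ c r s ≤ homogCost φ c' r s := by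
  simp only [homogCost_eq]
  gcongr

theorem homogCost_comm (φ : ℝ≥0 → ℝ≥0∞) (c : ℝ≥0∞) (r s : ℝ≥0) :
    homogCost φ c r s = homogCost φ c s r := by
  simp only [homogCost_eq, add_assoc, add_comm (persp φ _ r)]

theorem homogCost_zero_zero (φ : ℝ≥0 → ℝ≥0∞) (c : ℝ≥0∞) : homogCost φ c 0 0 = 0 := by
  rw [homogCost_eq, ← nonpos_iff_eq_zero]
  exact (iInf_le _ 0).trans (by simp [persp])

/-- The infimum may be restricted to `θ ∈ [0, r + s]`. -/
theorem IsEntropy.homogCost_eq_unit {φ : ℝ≥0 → ℝ≥0∞} (hφ : IsEntropy φ) (c : ℝ≥0∞) (r s : ℝ≥0) :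
    homogCost φ c r s = ⨅ η ∈ Icc (0 : ℝ≥0) 1, (((η * (r + s) : ℝ≥0) : ℝ≥0∞) * c +
      persp φ (η * (r + s)) r + persp φ (η * (r + s)) s) := by
  rw [homogCost_eq]
  refine le_antisymm (le_iInf₂ fun η _ => iInf_le _ _) (le_iInf fun θ => ?_)
  rcases le_total θ (r + s) with h | h
  · by_cases h0 : r + s = 0
    · refine (iInf₂_le 0 (by simp)).trans (le_of_eq ?_)
      have : θ = 0 := by simpa [h0] using h
      rw [zero_mul, this]
    · refine (iInf₂_le (θ / (r + s)) ⟨zero_le, div_le_one_of_le₀ h zero_le⟩).trans (le_of_eq ?_)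
      rw [div_mul_cancel₀ _ h0]
  -- Beyond `r + s`, which is at least `r` and `s`, all three terms are nondecreasing in `θ`.
  · refine (iInf₂_le 1 (by simp)).trans ?_
    rw [one_mul]
    gcongr
    · exact hφ.persp_mono (by simp) h
    · exact hφ.persp_mono (by simp) h

theorem homogCost_mul (φ : ℝ≥0 → ℝ≥0∞) (c : ℝ≥0∞) (k r s : ℝ≥0) :
    homogCost φ c (k * r) (k * s) = k * homogCost φ c r s := by
  by_cases hk : k = 0
  · simp [hk, homogCost_zero_zero]
  have hk' : (k : ℝ≥0∞) ≠ 0 := by simpa using hk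
  rw [homogCost_eq, homogCost_eq, ENNReal.mul_iInf_of_ne hk' ENNReal.coe_ne_top]
  refine (Equiv.iInf_congr (Equiv.mulLeft₀ k hk) fun θ => ?_).symm
  rw [Equiv.mulLeft₀_apply, persp_mul φ hk, persp_mul φ hk, ENNReal.coe_mul, mul_add, mul_add,
    mul_assoc]

theorem lowerSemicontinuous_iInf_of_isCompact {S T : Type*} [TopologicalSpace S]
    [TopologicalSpace T] {C : Set T} (hC : IsCompact C) {f : S → T → ℝ≥0∞}
    (hf : LowerSemicontinuous (fun z : S × T => f z.1 z.2)) :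
    LowerSemicontinuous (fun x => ⨅ η ∈ C, f x η) := by
  intro x y hy
  obtain ⟨y', hy1, hy2⟩ := exists_between hy
  have hopen : IsOpen {z : S × T | y' < f z.1 z.2} := hf.isOpen_preimage y'
  have hsub : ({x} : Set S) ×ˢ C ⊆ {z : S × T | y' < f z.1 z.2} := by
    rintro ⟨a, b⟩ ⟨ha, hb⟩
    obtain rfl : a = x := ha
    exact hy2.trans_le (iInf₂_le b hb)
  obtain ⟨U, V, hU, -, hxU, hCV, hUV⟩ := generalized_tube_lemma isCompact_singleton hC hopen hsub
  filter_upwards [hU.mem_nhds (hxU rfl)] with a ha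
  refine hy1.trans_le (le_iInf₂ fun η hη => ?_)
  have h : (a, η) ∈ {z : S × T | y' < f z.1 z.2} := hUV ⟨ha, hCV hη⟩
  exact le_of_lt h

/-- In the parametrization `θ = η (r + s)` the compact range of `η` does not move with `(r, s)`, so
the tube lemma applies. -/
theorem IsEntropy.lowerSemicontinuous_homogCost {φ : ℝ≥0 → ℝ≥0∞} (hφ : IsEntropy φ) {S : Type*}
    [TopologicalSpace S] {c : S → ℝ≥0∞} {r s : S → ℝ≥0} (hc : LowerSemicontinuous c)
    (hr : Continuous r) (hs : Continuous s) :
    LowerSemicontinuous (fun x => homogCost φ (c x) (r x) (s x)) := by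
  simp only [hφ.homogCost_eq_unit]
  refine lowerSemicontinuous_iInf_of_isCompact isCompact_Icc ?_
  have hθ : Continuous (fun z : S × ℝ≥0 => z.2 * (r z.1 + s z.1)) := by fun_prop
  refine LowerSemicontinuous.add (LowerSemicontinuous.add (fun z => ?_) ?_) ?_
  · exact LowerSemicontinuousAt.ennreal_mul
      ((ENNReal.continuous_coe.comp hθ).lowerSemicontinuous z)
      ((hc.comp continuous_fst) z)
  · exact hφ.lowerSemicontinuous_persp.comp (hθ.prodMk (hr.comp continuous_fst))
  · exact hφ.lowerSemicontinuous_persp.comp (hθ.prodMk (hs.comp continuous_fst))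

/-- The infimum is attained, and at a minimizer all three terms vanish, so `θ = r`, `θ = s` and `θ c
= 0`. Conversely `θ = r` is a witness. -/
theorem IsEntropy.homogCost_eq_zero_iff {φ : ℝ≥0 → ℝ≥0∞} (hφ : IsEntropy φ) {c : ℝ≥0∞}
    {r s : ℝ≥0} : homogCost φ c r s = 0 ↔ r = s ∧ (r = 0 ∨ c = 0) := by
  constructor
  · intro h
    have hlsc : LowerSemicontinuous (fun η : ℝ≥0 => ((η * (r + s) : ℝ≥0) : ℝ≥0∞) * c +
        persp φ (η * (r + s)) r + persp φ (η * (r + s)) s) := by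
      have hθ : Continuous (fun z : ℝ≥0 => z * (r + s)) := by fun_prop
      refine LowerSemicontinuous.add (LowerSemicontinuous.add (fun z => ?_) ?_) ?_
      · exact LowerSemicontinuousAt.ennreal_mul
          ((ENNReal.continuous_coe.comp hθ).lowerSemicontinuous z)
          (lowerSemicontinuous_const z)
      · exact hφ.lowerSemicontinuous_persp.comp (hθ.prodMk continuous_const)
      · exact hφ.lowerSemicontinuous_persp.comp (hθ.prodMk continuous_const)
    obtain ⟨η, hη, hmin⟩ := LowerSemicontinuousOn.exists_isMinOn ⟨0, by simp⟩
      (isCompact_Icc (a := (0 : ℝ≥0)) (b := 1)) (hlsc.lowerSemicontinuousOn _)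
    have h0 : ((η * (r + s) : ℝ≥0) : ℝ≥0∞) * c +
        persp φ (η * (r + s)) r + persp φ (η * (r + s)) s ≤ 0 := by
      rw [← h, hφ.homogCost_eq_unit]
      exact le_iInf₂ fun η' hη' => hmin hη'
    simp only [nonpos_iff_eq_zero, add_eq_zero, hφ.persp_eq_zero_iff, mul_eq_zero] at h0
    obtain ⟨⟨h1, h2⟩, h3⟩ := h0
    rw [h2] at h1 h3
    exact ⟨h3, by simpa using h1⟩
  · rintro ⟨rfl, h⟩
    rw [homogCost_eq, ← nonpos_iff_eq_zero]
    refine (iInf_le _ r).trans ?_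
    rw [hφ.persp_eq_zero_iff.2 rfl]
    simpa using h

/-! ### The cone kernel -/

/-- `H_{λ(Δ(t, u))}(a, b)`, and `H_0(a, b)` if `a = 0` or `b = 0`. -/
def coneKernel (φ lam : ℝ≥0 → ℝ≥0∞) (Δ : ℝ≥0 → ℝ≥0 → ℝ≥0) (t u a b : ℝ≥0) : ℝ≥0∞ :=
  homogCost φ (if a = 0 ∨ b = 0 then 0 else lam (Δ t u)) a b

/-- Costs on the cone over `ℝ₊`, in the coordinates `(t, a)` and `(u, b)` of two points, that are
lower semicontinuous, positively homogeneous, symmetric and definite. -/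
structure IsConeKernel (K : ℝ≥0 → ℝ≥0 → ℝ≥0 → ℝ≥0 → ℝ≥0∞) : Prop where
  lsc : LowerSemicontinuous fun z : (ℝ≥0 × ℝ≥0) × (ℝ≥0 × ℝ≥0) => K z.1.1 z.1.2 z.2.1 z.2.2
  homog : ∀ k t u a b, K t u (k * a) (k * b) = k * K t u a b
  eq_zero_iff : ∀ t u a b, K t u a b = 0 ↔ a = b ∧ (a = 0 ∨ t = u)
  apex : ∀ t u t' u' a b, a = 0 ∨ b = 0 → K t u a b = K t' u' a b
  symm : ∀ t u a b, K t u a b = K u t b a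
  base_le : ∀ t u a b, K 0 0 a b ≤ K t u a b

theorem isConeKernel_coneKernel {φ lam : ℝ≥0 → ℝ≥0∞} {Δ : ℝ≥0 → ℝ≥0 → ℝ≥0}
    (hφ : IsEntropy φ) (hlam : ∀ t, lam t = 0 ↔ t = 0)
    (hΔ : IsDistance (fun t u => (Δ t u : ℝ≥0∞)))
    (hlsc : LowerSemicontinuous (fun z : ℝ≥0 × ℝ≥0 => lam (Δ z.1 z.2))) :
    IsConeKernel (coneKernel φ lam Δ) where
  lsc := by
    refine hφ.lowerSemicontinuous_homogCost ?_ (by fun_prop) (by fun_prop)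
    intro z y hy
    -- Where a weight is zero the modified `c` takes its least value `0`, so lower semicontinuity is
    -- automatic; elsewhere `c` is locally `lam (Δ t u)`.
    by_cases hz : z.2.1 = 0 ∨ z.2.2 = 0
    · simp [hz] at hy
    · simp only [hz, if_false] at hy
      have h1 : ∀ᶠ w : (ℝ≥0 × ℝ≥0) × (ℝ≥0 × ℝ≥0) in 𝓝 z, y < lam (Δ w.1.1 w.1.2) :=
        hlsc.comp continuous_fst z y hy
      push Not at hz
      have h2 : ∀ᶠ w : (ℝ≥0 × ℝ≥0) × (ℝ≥0 × ℝ≥0) in 𝓝 z, w.2.1 ≠ 0 :=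
        (continuous_fst.comp continuous_snd).continuousAt.eventually_ne hz.1
      have h3 : ∀ᶠ w : (ℝ≥0 × ℝ≥0) × (ℝ≥0 × ℝ≥0) in 𝓝 z, w.2.2 ≠ 0 :=
        (continuous_snd.comp continuous_snd).continuousAt.eventually_ne hz.2
      filter_upwards [h1, h2, h3] with w hw1 hw2 hw3
      simpa [hw2, hw3] using hw1
  homog k t u a b := by
    by_cases hk : k = 0
    · simp [coneKernel, hk, homogCost_zero_zero]
    · simp [coneKernel, hk, homogCost_mul]
  eq_zero_iff t u a b := by
    have hd : lam (Δ t u) = 0 ↔ t = u := by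
      rw [hlam]
      simpa using hΔ.eq_zero_iff t u
    rw [coneKernel, hφ.homogCost_eq_zero_iff]
    refine and_congr_right fun hab => ?_
    subst hab
    by_cases ha : a = 0 <;> simp [ha, hd]
  apex t u t' u' a b h := by simp [coneKernel, h]
  symm t u a b := by
    have : Δ t u = Δ u t := by simpa using hΔ.symm t u
    rw [coneKernel, coneKernel, homogCost_comm, this]
    simp only [or_comm]
  base_le t u a b := by
    refine homogCost_mono φ ?_ a b
    have : lam (Δ 0 0) = 0 := (hlam _).2 (by simpa using (hΔ.eq_zero_iff 0 0).2 rfl)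
    simp [this]

/-- At the apex the base point is free. Choosing it equal to the other one makes `lam (Δ v v) = 0`,
the smallest possible `c`, so the infimum over representatives is `H_0`. -/
theorem coneDist_mk_rpow_eq_coneKernel {φ lam : ℝ≥0 → ℝ≥0∞} {Δ : ℝ≥0 → ℝ≥0 → ℝ≥0} {p q : ℝ}
    (hlam : ∀ t, lam t = 0 ↔ t = 0) (hΔ : IsDistance (fun t u => (Δ t u : ℝ≥0∞)))
    (hp : 0 < p) (hq : 0 < q) (t r u s : ℝ≥0) :
    coneDist φ lam Δ p q (Cone.mk t r) (Cone.mk u s) ^ q =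
      coneKernel φ lam Δ t u (r ^ p) (s ^ p) := by
  have hz : ∀ x : ℝ≥0, x ^ p = 0 ↔ x = 0 := fun x => by simp [NNReal.rpow_eq_zero_iff, hp.ne']
  have hd : ∀ t, lam (Δ t t) = 0 := fun t => by
    rw [hlam]
    simpa using (hΔ.eq_zero_iff t t).2 rfl
  by_cases h : r = 0 ∨ s = 0
  · rw [coneKernel, if_pos (by simpa only [hz] using h), coneDist, ← ENNReal.rpow_mul, one_div,
      inv_mul_cancel₀ hq.ne', ENNReal.rpow_one]
    refine le_antisymm ?_ ?_
    · obtain ⟨v, h1, h2⟩ : ∃ v, Cone.mk v r = Cone.mk t r ∧ Cone.mk v s = Cone.mk u s := by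
        rcases h with h | h
        · exact ⟨u, Cone.mk_eq_mk.2 (Or.inr ⟨h, h⟩), rfl⟩
        · exact ⟨t, rfl, Cone.mk_eq_mk.2 (Or.inr ⟨h, h⟩)⟩
      rw [← hd v]
      exact iInf_le_of_le v <| iInf_le_of_le r <| iInf_le_of_le h1 <| iInf_le_of_le v <|
        iInf_le_of_le s <| iInf_le_of_le h2 le_rfl
    · refine le_iInf fun t' => le_iInf fun r' => le_iInf fun h1 => le_iInf fun u' =>
        le_iInf fun s' => le_iInf fun h2 => ?_
      rw [Cone.mk_eq_mk] at h1 h2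
      have e1 : r' = r := by rcases h1 with h1 | h1 <;> simp [h1]
      have e2 : s' = s := by rcases h2 with h2 | h2 <;> simp [h2]
      subst e1 e2
      exact homogCost_mono φ zero_le _ _
  · rw [coneKernel, if_neg (by simpa only [hz] using h)]
    push Not at h
    exact coneDist_mk_rpow_of_pos φ lam Δ p q hq t r u s (pos_of_ne_zero h.1) (pos_of_ne_zero h.2)

/-! ### Plans in product coordinates

A point `[x, r]` of the cone is described by the pair `(x, a)` with `a = r ^ p`. -/

section Lifted

variable {X Y Z : Type*} [MetricSpace X] [MetricSpace Y] [MetricSpace Z]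

/-- The cost of a pair of points of `(X × ℝ₊) × (Y × ℝ₊)`. -/
def pairCost (K : ℝ≥0 → ℝ≥0 → ℝ≥0 → ℝ≥0 → ℝ≥0∞) (w z : (X × ℝ≥0) × (Y × ℝ≥0)) : ℝ≥0∞ :=
  K (nndist w.1.1 z.1.1) (nndist w.2.1 z.2.1) (w.1.2 * z.1.2) (w.2.2 * z.2.2)

theorem IsConeKernel.lowerSemicontinuous_pairCost {K : ℝ≥0 → ℝ≥0 → ℝ≥0 → ℝ≥0 → ℝ≥0∞}
    (hK : IsConeKernel K) :
    LowerSemicontinuous fun v : ((X × ℝ≥0) × (Y × ℝ≥0)) × ((X × ℝ≥0) × (Y × ℝ≥0)) =>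
      pairCost K v.1 v.2 := by
  have h : Continuous fun v : ((X × ℝ≥0) × (Y × ℝ≥0)) × ((X × ℝ≥0) × (Y × ℝ≥0)) =>
      ((nndist v.1.1.1 v.2.1.1, nndist v.1.2.1 v.2.2.1),
        (v.1.1.2 * v.2.1.2, v.1.2.2 * v.2.2.2)) := by fun_prop
  exact hK.lsc.comp h

/-- Weights enter through products, so the two points can be rescaled by independent factors; a base
point matters only where its weight is nonzero. -/
theorem IsConeKernel.pairCost_scale {K : ℝ≥0 → ℝ≥0 → ℝ≥0 → ℝ≥0 → ℝ≥0∞} (hK : IsConeKernel K)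
    {k k' : ℝ≥0} {w z w' z' : (X × ℝ≥0) × (Y × ℝ≥0)}
    (h1 : k * w'.1.2 = w.1.2) (h2 : k * w'.2.2 = w.2.2) (h3 : k' * z'.1.2 = z.1.2)
    (h4 : k' * z'.2.2 = z.2.2) (g1 : w.1.2 ≠ 0 → w'.1.1 = w.1.1) (g2 : w.2.2 ≠ 0 → w'.2.1 = w.2.1)
    (g3 : z.1.2 ≠ 0 → z'.1.1 = z.1.1) (g4 : z.2.2 ≠ 0 → z'.2.1 = z.2.1) :
    (k : ℝ≥0∞) * (k' * pairCost K w' z') = pairCost K w z := by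
  rw [pairCost, ← mul_assoc, ← ENNReal.coe_mul, ← hK.homog, mul_mul_mul_comm, h1, h3,
    mul_mul_mul_comm, h2, h4, pairCost]
  by_cases h : w.1.2 * z.1.2 = 0 ∨ w.2.2 * z.2.2 = 0
  · exact hK.apex _ _ _ _ _ _ h
  · push Not at h
    rw [g1 (left_ne_zero_of_mul h.1), g2 (left_ne_zero_of_mul h.2),
      g3 (right_ne_zero_of_mul h.1), g4 (right_ne_zero_of_mul h.2)]

theorem IsConeKernel.pairCost_swap {K : ℝ≥0 → ℝ≥0 → ℝ≥0 → ℝ≥0 → ℝ≥0∞} (hK : IsConeKernel K)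
    (w z : (X × ℝ≥0) × (Y × ℝ≥0)) : pairCost K w.swap z.swap = pairCost K w z :=
  hK.symm _ _ _ _

variable [MeasurableSpace X] [MeasurableSpace Y] [MeasurableSpace Z]

/-- The double integral of the pair cost. -/
def energy (K : ℝ≥0 → ℝ≥0 → ℝ≥0 → ℝ≥0 → ℝ≥0∞) (α : Measure ((X × ℝ≥0) × (Y × ℝ≥0))) : ℝ≥0∞ :=
  ∫⁻ w, ∫⁻ z, pairCost K w z ∂α ∂α

/-- The conic marginal conditions in product coordinates. -/
structure IsLiftedPlan (μ : Measure X) (ν : Measure Y) (α : Measure ((X × ℝ≥0) × (Y × ℝ≥0))) :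
    Prop where
  finite : IsFiniteMeasure α
  left : ∀ f : X → ℝ≥0∞, Measurable f → ∫⁻ w, w.1.2 * f w.1.1 ∂α = ∫⁻ x, f x ∂μ
  right : ∀ f : Y → ℝ≥0∞, Measurable f → ∫⁻ w, w.2.2 * f w.2.1 ∂α = ∫⁻ y, f y ∂ν

theorem lintegral_map_withDensity {S T : Type*} [MeasurableSpace S] [MeasurableSpace T]
    (α : Measure S) {ω : S → ℝ≥0} (hω : Measurable ω) {F : S → T} (hF : Measurable F)
    {g : T → ℝ≥0∞} (hg : Measurable g) :
    ∫⁻ z, g z ∂((α.withDensity fun w => (ω w : ℝ≥0∞)).map F) = ∫⁻ w, ω w * g (F w) ∂α := by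
  rw [lintegral_map hg hF]
  exact lintegral_withDensity_eq_lintegral_mul _ hω.coe_nnreal_ennreal (hg.comp hF)

variable [BorelSpace X] [BorelSpace Y] [BorelSpace Z] [SecondCountableTopology X]
  [SecondCountableTopology Y] [SecondCountableTopology Z]

theorem IsConeKernel.measurable_pairCost {K : ℝ≥0 → ℝ≥0 → ℝ≥0 → ℝ≥0 → ℝ≥0∞}
    (hK : IsConeKernel K) :
    Measurable fun v : ((X × ℝ≥0) × (Y × ℝ≥0)) × ((X × ℝ≥0) × (Y × ℝ≥0)) =>
      pairCost K v.1 v.2 :=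
  hK.lowerSemicontinuous_pairCost.measurable

theorem IsConeKernel.energy_map {K : ℝ≥0 → ℝ≥0 → ℝ≥0 → ℝ≥0 → ℝ≥0∞} (hK : IsConeKernel K)
    {S : Type*} [MeasurableSpace S] (α : Measure S) [IsFiniteMeasure α]
    {F : S → (X × ℝ≥0) × (Y × ℝ≥0)} (hF : Measurable F) :
    energy K (α.map F) = ∫⁻ w, ∫⁻ z, pairCost K (F w) (F z) ∂α ∂α := by
  rw [energy, lintegral_map hK.measurable_pairCost.lintegral_prod_right' hF]
  refine lintegral_congr fun w => ?_
  exact lintegral_map (hK.measurable_pairCost.comp measurable_prodMk_left) hF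

/-- Mass is multiplied by `ω` and weights are divided by it. The constraints are linear in the
weights and the energy is homogeneous in each of the two points, so nothing changes. -/
theorem IsLiftedPlan.reweight {K : ℝ≥0 → ℝ≥0 → ℝ≥0 → ℝ≥0 → ℝ≥0∞} (hK : IsConeKernel K)
    {μ : Measure X} {ν : Measure Y} {α : Measure ((X × ℝ≥0) × (Y × ℝ≥0))}
    (hα : IsLiftedPlan μ ν α) {ω : (X × ℝ≥0) × (Y × ℝ≥0) → ℝ≥0} (hω : Measurable ω)
    {F : (X × ℝ≥0) × (Y × ℝ≥0) → (X × ℝ≥0) × (Y × ℝ≥0)} (hF : Measurable F)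
    (h1 : ∀ w, ω w * (F w).1.2 = w.1.2) (h2 : ∀ w, ω w * (F w).2.2 = w.2.2)
    (g1 : ∀ w, w.1.2 ≠ 0 → (F w).1.1 = w.1.1) (g2 : ∀ w, w.2.2 ≠ 0 → (F w).2.1 = w.2.1)
    (hfin : ∫⁻ w, ω w ∂α ≠ ∞) :
    IsLiftedPlan μ ν ((α.withDensity fun w => (ω w : ℝ≥0∞)).map F) ∧
      energy K ((α.withDensity fun w => (ω w : ℝ≥0∞)).map F) = energy K α := by
  have := hα.finite
  have hfin' : IsFiniteMeasure (α.withDensity fun w => (ω w : ℝ≥0∞)) :=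
    isFiniteMeasure_withDensity hfin
  refine ⟨⟨inferInstance, fun f hf => ?_, fun f hf => ?_⟩, ?_⟩
  · rw [← hα.left f hf, lintegral_map_withDensity α hω hF (by fun_prop)]
    refine lintegral_congr fun w => ?_
    rw [← mul_assoc, ← ENNReal.coe_mul, h1]
    by_cases h : w.1.2 = 0
    · simp [h]
    · rw [g1 w h]
  · rw [← hα.right f hf, lintegral_map_withDensity α hω hF (by fun_prop)]
    refine lintegral_congr fun w => ?_
    rw [← mul_assoc, ← ENNReal.coe_mul, h2]
    by_cases h : w.2.2 = 0
    · simp [h]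
    · rw [g2 w h]
  · rw [energy, lintegral_map_withDensity α hω hF hK.measurable_pairCost.lintegral_prod_right',
      energy]
    refine lintegral_congr fun w => ?_
    have hm : Measurable fun z => pairCost K (F w) z :=
      hK.measurable_pairCost.comp measurable_prodMk_left
    have hm' : Measurable fun z => (ω z : ℝ≥0∞) * pairCost K (F w) (F z) :=
      hω.coe_nnreal_ennreal.mul (hm.comp hF)
    rw [lintegral_map_withDensity α hω hF hm, ← lintegral_const_mul _ hm']
    exact lintegral_congr fun z => hK.pairCost_scale (h1 w) (h2 w) (h1 z) (h2 z) (g1 w) (g2 w)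
      (g1 z) (g2 z)

theorem IsLiftedPlan.swap {K : ℝ≥0 → ℝ≥0 → ℝ≥0 → ℝ≥0 → ℝ≥0∞} (hK : IsConeKernel K)
    {μ : Measure X} {ν : Measure Y} {α : Measure ((X × ℝ≥0) × (Y × ℝ≥0))}
    (hα : IsLiftedPlan μ ν α) :
    IsLiftedPlan ν μ (α.map Prod.swap) ∧ energy K (α.map Prod.swap) = energy K α := by
  have := hα.finite
  refine ⟨⟨inferInstance, fun f hf => ?_, fun f hf => ?_⟩, ?_⟩
  · rw [← hα.right f hf, lintegral_map (by fun_prop) measurable_swap]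
    rfl
  · rw [← hα.left f hf, lintegral_map (by fun_prop) measurable_swap]
    rfl
  · rw [hK.energy_map α measurable_swap]
    simp only [hK.pairCost_swap]
    rfl

end Lifted

/-! ### Representatives of cone points -/

theorem Cone.measurable_mk {X : Type*} [MeasurableSpace X] :
    Measurable fun a : X × ℝ≥0 => Cone.mk a.1 a.2 :=
  measurable_quotient_mk' (s := coneSetoid X)

section Rep

variable {X : Type*} [Nonempty X]

/-- The representative `(x, r)` of a cone point, with a fixed `x` for the apex. -/
def Cone.rep : Cone X → X × ℝ≥0 :=
  Quotient.lift (fun a : X × ℝ≥0 => if a.2 = 0 then (Classical.arbitrary X, 0) else a) (by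
    rintro a b (rfl | ⟨h, h'⟩)
    · rfl
    · simp [h, h'])

theorem Cone.rep_mk (x : X) (r : ℝ≥0) :
    (Cone.mk x r).rep = if r = 0 then (Classical.arbitrary X, 0) else (x, r) := rfl

theorem Cone.rep_mk_snd (x : X) (r : ℝ≥0) : (Cone.mk x r).rep.2 = r := by
  rw [Cone.rep_mk]; split_ifs with h <;> simp [h]

theorem Cone.rep_mk_fst (x : X) {r : ℝ≥0} (hr : r ≠ 0) : (Cone.mk x r).rep.1 = x := by
  rw [Cone.rep_mk, if_neg hr]

theorem Cone.mk_rep (c : Cone X) : Cone.mk c.rep.1 c.rep.2 = c := by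
  induction c using Quotient.inductionOn with
  | h a =>
    by_cases h : a.2 = 0
    · exact Cone.mk_eq_mk.2 (Or.inr ⟨(Cone.rep_mk_snd a.1 a.2).trans h, h⟩)
    · exact Cone.mk_eq_mk.2 (Or.inl ⟨Cone.rep_mk_fst a.1 h, Cone.rep_mk_snd a.1 a.2⟩)

theorem Cone.radius_eq (c : Cone X) : c.radius = c.rep.2 := by
  conv_lhs => rw [← c.mk_rep]
  rfl

variable [MeasurableSpace X]

theorem Cone.measurable_rep : Measurable (Cone.rep : Cone X → X × ℝ≥0) := by
  refine (measurable_from_quotient (s := coneSetoid X)).2 ?_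
  change Measurable fun a : X × ℝ≥0 => if a.2 = 0 then (Classical.arbitrary X, 0) else a
  exact Measurable.ite (measurable_snd (measurableSet_singleton 0)) measurable_const measurable_id

/-- The image of `A ×ˢ univ` and the preimage of `A` under the representative differ at most at the
apex, where the integrand is `0 ^ p = 0`. -/
theorem hasConicMarginal_iff {p : ℝ} (hp : 0 < p) (β : Measure (Cone X)) (μ : Measure X) :
    HasConicMarginal p β μ ↔ ∀ f : X → ℝ≥0∞, Measurable f →
      ∫⁻ c, ((c.rep.2 ^ p : ℝ≥0) : ℝ≥0∞) * f c.rep.1 ∂β = ∫⁻ x, f x ∂μ := by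
  have hw : Measurable fun c : Cone X => c.rep.2 ^ p :=
    (Cone.measurable_rep.snd).pow_const p
  have key : ∀ A : Set X, MeasurableSet A →
      ∫⁻ c in (fun a : X × ℝ≥0 => Cone.mk a.1 a.2) '' (A ×ˢ univ),
        ((c.radius ^ p : ℝ≥0) : ℝ≥0∞) ∂β
      = ∫⁻ c, ((c.rep.2 ^ p : ℝ≥0) : ℝ≥0∞) * A.indicator 1 c.rep.1 ∂β := by
    intro A hA
    have hmem : ∀ x : X, ∀ r : ℝ≥0, Cone.mk x r ∈ (fun a : X × ℝ≥0 => Cone.mk a.1 a.2) ''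
        (A ×ˢ univ) ↔ x ∈ A ∨ (r = 0 ∧ A.Nonempty) := by
      intro x r
      constructor
      · rintro ⟨⟨y, s⟩, ⟨hy, -⟩, h⟩
        rcases Cone.mk_eq_mk.1 h with ⟨rfl, -⟩ | ⟨-, h⟩
        · exact Or.inl hy
        · exact Or.inr ⟨h, _, hy⟩
      · rintro (h | ⟨h, y, hy⟩)
        · exact ⟨(x, r), ⟨h, mem_univ _⟩, rfl⟩
        · exact ⟨(y, 0), ⟨hy, mem_univ _⟩, Cone.mk_eq_mk.2 (Or.inr ⟨rfl, h⟩)⟩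
    have hmeas : MeasurableSet ((fun a : X × ℝ≥0 => Cone.mk a.1 a.2) '' (A ×ˢ univ)) := by
      refine (measurableSet_quotient (s := coneSetoid X)).2 ?_
      change MeasurableSet {a : X × ℝ≥0 | Cone.mk a.1 a.2 ∈ _}
      simp only [hmem]
      refine (measurable_fst hA).union ?_
      exact (measurable_snd (measurableSet_singleton (0 : ℝ≥0))).inter (MeasurableSet.const _)
    rw [← lintegral_indicator hmeas]
    refine lintegral_congr fun c => ?_
    obtain ⟨x, r, rfl⟩ : ∃ x r, Cone.mk x r = c := ⟨_, _, c.mk_rep⟩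
    rw [Cone.rep_mk_snd]
    by_cases hr : r = 0
    · simp [indicator, Cone.radius_eq, Cone.rep_mk_snd, hr, hp.ne']
    · rw [Cone.rep_mk_fst x hr]
      by_cases hx : x ∈ A
      · rw [indicator_of_mem ((hmem x r).2 (Or.inl hx)), indicator_of_mem hx, Cone.radius_eq,
          Cone.rep_mk_snd]
        simp
      · rw [indicator_of_notMem (fun h => ?_), indicator_of_notMem hx, mul_zero]
        rcases (hmem x r).1 h with h | h
        · exact hx h
        · exact hr h.1
  constructor
  · intro h f hf
    have hμ : (β.withDensity fun c => ((c.rep.2 ^ p : ℝ≥0) : ℝ≥0∞)).map (fun c => c.rep.1) = μ := by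
      refine Measure.ext fun A hA => ?_
      rw [← h A hA, key A hA, ← lintegral_map_withDensity β hw Cone.measurable_rep.fst
        (measurable_one.indicator hA), lintegral_indicator_one hA]
    rw [← hμ, lintegral_map_withDensity β hw Cone.measurable_rep.fst hf]
  · intro h A hA
    rw [key A hA, h _ (measurable_one.indicator hA), lintegral_indicator_one hA]

end Rep

/-! ### The divergence in product coordinates -/

instance MMSpace.secondCountableTopology (X : MMSpace.{u}) : SecondCountableTopology X.carrier :=
  UniformSpace.secondCountable_of_separable X.carrier

theorem CGW_eq {φ lam : ℝ≥0 → ℝ≥0∞} {Δ : ℝ≥0 → ℝ≥0 → ℝ≥0} {p q : ℝ}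
    (hK : IsConeKernel (coneKernel φ lam Δ))
    (hD : ∀ t r u s : ℝ≥0, coneDist φ lam Δ p q (Cone.mk t r) (Cone.mk u s) ^ q =
      coneKernel φ lam Δ t u (r ^ p) (s ^ p)) (hp : 0 < p) (X Y : MMSpace.{u}) :
    CGW φ lam Δ p q X Y = ⨅ α ∈ {α | IsLiftedPlan X.meas Y.meas α},
      energy (coneKernel φ lam Δ) α := by
  set S : Cone X.carrier × Cone Y.carrier → (X.carrier × ℝ≥0) × (Y.carrier × ℝ≥0) :=
    fun w => ((w.1.rep.1, w.1.rep.2 ^ p), (w.2.rep.1, w.2.rep.2 ^ p)) with hS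
  have hSm : Measurable S := by
    have h1 : Measurable fun w : Cone X.carrier × Cone Y.carrier => w.1.rep :=
      Cone.measurable_rep.comp measurable_fst
    have h2 : Measurable fun w : Cone X.carrier × Cone Y.carrier => w.2.rep :=
      Cone.measurable_rep.comp measurable_snd
    exact (h1.fst.prodMk (h1.snd.pow_const p)).prodMk (h2.fst.prodMk (h2.snd.pow_const p))
  have hcost : ∀ w z : Cone X.carrier × Cone Y.carrier,
      coneDist φ lam Δ p q (Cone.pair w.1 z.1) (Cone.pair w.2 z.2) ^ q =
        pairCost (coneKernel φ lam Δ) (S w) (S z) := by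
    rintro ⟨w1, w2⟩ ⟨z1, z2⟩
    have hpair : ∀ {T : MMSpace.{u}} (c d : Cone T.carrier),
        Cone.pair c d = Cone.mk (nndist c.rep.1 d.rep.1) (c.rep.2 * d.rep.2) := by
      intro T c d
      conv_lhs => rw [← c.mk_rep, ← d.mk_rep]
      rfl
    simp only [hpair, hD, NNReal.mul_rpow, hS, pairCost]
  have hfun : ∀ α : Measure (Cone X.carrier × Cone Y.carrier), IsFiniteMeasure α →
      conicFunctional φ lam Δ p q α = energy (coneKernel φ lam Δ) (α.map S) := by
    intro α hα
    rw [hK.energy_map α hSm, conicFunctional]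
    simp only [hcost]
  refine le_antisymm ?_ ?_
  · refine le_iInf₂ fun α hα => ?_
    have hα : IsLiftedPlan X.meas Y.meas α := hα
    have := hα.finite
    set M : (X.carrier × ℝ≥0) × (Y.carrier × ℝ≥0) → Cone X.carrier × Cone Y.carrier :=
      fun w => (Cone.mk w.1.1 (w.1.2 ^ p⁻¹), Cone.mk w.2.1 (w.2.2 ^ p⁻¹)) with hM
    have hMm : Measurable M := by
      refine Measurable.prodMk ?_ ?_
      · exact Cone.measurable_mk.comp (f := fun w : (X.carrier × ℝ≥0) × (Y.carrier × ℝ≥0) =>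
          (w.1.1, w.1.2 ^ p⁻¹)) (by fun_prop)
      · exact Cone.measurable_mk.comp (f := fun w : (X.carrier × ℝ≥0) × (Y.carrier × ℝ≥0) =>
          (w.2.1, w.2.2 ^ p⁻¹)) (by fun_prop)
    have hpow : ∀ a : ℝ≥0, (a ^ p⁻¹) ^ p = a := fun a => NNReal.rpow_inv_rpow hp.ne' a
    have hpow0 : ∀ a : ℝ≥0, a ≠ 0 → a ^ p⁻¹ ≠ 0 := fun a ha => by
      simp [NNReal.rpow_eq_zero_iff, ha]
    refine (iInf₂_le (α.map M) ?_).trans (le_of_eq ?_)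
    · refine ⟨inferInstance, ?_, ?_⟩
      · rw [hasConicMarginal_iff hp]
        intro f hf
        have hm : Measurable fun c : Cone X.carrier =>
            ((c.rep.2 ^ p : ℝ≥0) : ℝ≥0∞) * f c.rep.1 :=
          (Cone.measurable_rep.snd.pow_const p).coe_nnreal_ennreal.mul
            (hf.comp Cone.measurable_rep.fst)
        rw [Measure.fst, Measure.map_map measurable_fst hMm,
          lintegral_map hm (measurable_fst.comp hMm), ← hα.left f hf]
        refine lintegral_congr fun w => ?_
        simp only [Function.comp_apply, hM, Cone.rep_mk_snd, hpow]
        by_cases h : w.1.2 = 0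
        · simp [h]
        · rw [Cone.rep_mk_fst _ (hpow0 _ h)]
      · rw [hasConicMarginal_iff hp]
        intro f hf
        have hm : Measurable fun c : Cone Y.carrier =>
            ((c.rep.2 ^ p : ℝ≥0) : ℝ≥0∞) * f c.rep.1 :=
          (Cone.measurable_rep.snd.pow_const p).coe_nnreal_ennreal.mul
            (hf.comp Cone.measurable_rep.fst)
        rw [Measure.snd, Measure.map_map measurable_snd hMm,
          lintegral_map hm (measurable_snd.comp hMm), ← hα.right f hf]
        refine lintegral_congr fun w => ?_
        simp only [Function.comp_apply, hM, Cone.rep_mk_snd, hpow]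
        by_cases h : w.2.2 = 0
        · simp [h]
        · rw [Cone.rep_mk_fst _ (hpow0 _ h)]
    · rw [hfun _ inferInstance, Measure.map_map hSm hMm, hK.energy_map α (hSm.comp hMm), energy]
      refine lintegral_congr fun w => lintegral_congr fun z => ?_
      -- `S ∘ M` is not the identity: it resets the base point where the weight is zero. Scaling
      -- with factor `1` shows that the cost does not see this.
      have h := hK.pairCost_scale (k := 1) (k' := 1) (w := w) (z := z) (w' := S (M w))
        (z' := S (M z)) (by simp [hS, hM, Cone.rep_mk_snd, hpow])
        (by simp [hS, hM, Cone.rep_mk_snd, hpow]) (by simp [hS, hM, Cone.rep_mk_snd, hpow])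
        (by simp [hS, hM, Cone.rep_mk_snd, hpow]) (fun h => Cone.rep_mk_fst _ (hpow0 _ h))
        (fun h => Cone.rep_mk_fst _ (hpow0 _ h)) (fun h => Cone.rep_mk_fst _ (hpow0 _ h))
        (fun h => Cone.rep_mk_fst _ (hpow0 _ h))
      simpa using h
  · refine le_iInf₂ fun α hα => ?_
    obtain ⟨hfin, h1, h2⟩ := hα
    refine (iInf₂_le (α.map S) ?_).trans (hfun α hfin).ge
    rw [hasConicMarginal_iff hp] at h1 h2
    refine ⟨inferInstance, fun f hf => ?_, fun f hf => ?_⟩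
    · rw [← h1 f hf, lintegral_map (by fun_prop) hSm, Measure.fst, lintegral_map ?_ measurable_fst]
      exact (Cone.measurable_rep.snd.pow_const p).coe_nnreal_ennreal.mul
            (hf.comp Cone.measurable_rep.fst)
    · rw [← h2 f hf, lintegral_map (by fun_prop) hSm, Measure.snd, lintegral_map ?_ measurable_snd]
      exact (Cone.measurable_rep.snd.pow_const p).coe_nnreal_ennreal.mul
            (hf.comp Cone.measurable_rep.fst)

/-! ### Isometries from measures on products -/

/-- A continuous map that preserves distances on the support of `γ` maps it isometrically onto the
support of the image measure. -/
theorem exists_isometryEquiv_support {W X : Type*} [MetricSpace W] [CompleteSpace W]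
    [SecondCountableTopology W] [MeasurableSpace W] [BorelSpace W] [MetricSpace X]
    [SecondCountableTopology X] [MeasurableSpace X] [BorelSpace X] {γ : Measure W} {μ : Measure X}
    {f : W → X} (hf : Continuous f) (hμ : γ.map f = μ)
    (hd : ∀ w ∈ γ.support, ∀ z ∈ γ.support, dist (f w) (f z) = dist w z) :
    ∃ e : γ.support ≃ᵢ μ.support,
      (γ.comap (Subtype.val : γ.support → W)).map e =
        μ.comap (Subtype.val : μ.support → X) := by
  subst hμ
  have hmem : ∀ w ∈ γ.support, f w ∈ (γ.map f).support := by
    intro w hw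
    rw [Measure.mem_support_iff_forall] at hw ⊢
    intro U hU
    exact (hw _ (hf.continuousAt hU)).trans_le (Measure.le_map_apply hf.aemeasurable U)
  have hiso : Isometry fun w : γ.support => f w :=
    Isometry.of_dist_eq fun w z => hd w w.2 z z.2
  -- An isometric image of a complete space is closed. Since it has full measure, it contains the
  -- support of the image measure, which gives surjectivity.
  have hcl : IsClosed (f '' γ.support) := by
    have : CompleteSpace γ.support := Measure.isClosed_support.completeSpace_coe
    have h := hiso.isClosedEmbedding.isClosed_range
    rwa [← image_eq_range] at h
  have hsub : (γ.map f).support ⊆ f '' γ.support := by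
    refine Measure.support_subset_of_isClosed hcl ?_
    rw [mem_ae_iff, Measure.map_apply hf.measurable hcl.measurableSet.compl]
    refine measure_mono_null (fun w hw hw' => hw ⟨w, hw', rfl⟩) Measure.measure_compl_support
  let F : γ.support → (γ.map f).support := fun w => ⟨f w, hmem w w.2⟩
  have hF : Isometry F := Isometry.of_dist_eq fun w z => hd w w.2 z z.2
  have hFs : Function.Surjective F := by
    rintro ⟨x, hx⟩
    obtain ⟨w, hw, rfl⟩ := hsub hx
    exact ⟨⟨w, hw⟩, rfl⟩
  let e : γ.support ≃ᵢ (γ.map f).support :=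
    ⟨Equiv.ofBijective F ⟨hF.injective, hFs⟩, hF⟩
  refine ⟨e, ?_⟩
  have hms : MeasurableSet γ.support := Measure.isClosed_support.measurableSet
  have hms' : MeasurableSet (γ.map f).support := Measure.isClosed_support.measurableSet
  have hemb := MeasurableEmbedding.subtype_coe hms'
  have hval : (((γ.comap (Subtype.val : γ.support → W)).map e).map
      (Subtype.val : (γ.map f).support → X)) = γ.map f := by
    rw [Measure.map_map measurable_subtype_coe e.continuous.measurable]
    change (γ.comap (Subtype.val : γ.support → W)).map (f ∘ Subtype.val) = _
    have hr : γ.restrict γ.support = γ :=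
      Measure.restrict_eq_self_of_ae_mem (s := γ.support) Measure.support_mem_ae
    rw [← Measure.map_map hf.measurable measurable_subtype_coe, map_comap_subtype_coe hms, hr]
  exact (hemb.comap_map _).symm.trans (congrArg (Measure.comap Subtype.val) hval)

/-! ### Weak limits of finite measures -/

/-- The open half of the portmanteau theorem: a closed subset of `U` already carries more than `y`,
and a continuous function equal to `1` on it and `0` off `U` can be tested against the limit. -/
theorem eventually_lt_measure_of_isOpen {W ι : Type*} [MetricSpace W] [MeasurableSpace W]
    [BorelSpace W] {F : Filter ι} {r : ι → FiniteMeasure W} {ρ : FiniteMeasure W}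
    (h : Tendsto r F (𝓝 ρ)) {U : Set W} (hU : IsOpen U) {y : ℝ≥0∞} (hy : y < (ρ : Measure W) U) :
    ∀ᶠ n in F, y < (r n : Measure W) U := by
  obtain ⟨C, hCU, hC, hyC⟩ := hU.exists_lt_isClosed hy
  obtain ⟨f, hf0, hf1, hf⟩ := exists_continuous_zero_one_of_isClosed hU.isClosed_compl hC
    (disjoint_compl_left_iff_subset.2 hCU)
  let g : BoundedContinuousFunction W ℝ≥0 :=
    BoundedContinuousFunction.mkOfBound ⟨fun w => (f w).toNNReal, by fun_prop⟩ 1 (by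
      intro a b
      have : ∀ x, (((f x).toNNReal : ℝ≥0) : ℝ) ∈ Icc (0 : ℝ) 1 := fun x => by
        rw [Real.coe_toNNReal _ (hf x).1]; exact hf x
      change dist (f a).toNNReal (f b).toNNReal ≤ 1
      rw [NNReal.dist_eq]
      have := Real.dist_le_of_mem_Icc (this a) (this b)
      simpa [Real.dist_eq] using this)
  have hlim := FiniteMeasure.tendsto_iff_forall_lintegral_tendsto.1 h g
  have hlow : (ρ : Measure W) C ≤ ∫⁻ w, g w ∂(ρ : Measure W) := by
    rw [← lintegral_indicator_one hC.measurableSet]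
    refine lintegral_mono fun w => ?_
    by_cases hw : w ∈ C
    · have : g w = 1 := by
        change (f w).toNNReal = 1
        simp [hf1 hw]
      simp [hw, this]
    · simp [hw]
  filter_upwards [hlim.eventually_const_lt (hyC.trans_le hlow)] with n hn
  refine hn.trans_le ?_
  rw [← lintegral_indicator_one hU.measurableSet]
  refine lintegral_mono fun w => ?_
  by_cases hw : w ∈ U
  · have : g w ≤ 1 := Real.toNNReal_le_one.2 (hf w).2
    simpa [hw] using this
  · have : g w = 0 := by
      change (f w).toNNReal = 0
      simp [hf0 (show w ∈ Uᶜ from hw)]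
    simp [this]

theorem measure_le_of_forall_isOpen {X : Type*} [TopologicalSpace X] [MeasurableSpace X]
    [OpensMeasurableSpace X] {μ ν : Measure X} [ν.OuterRegular]
    (h : ∀ U, IsOpen U → μ U ≤ ν U) : μ ≤ ν := by
  refine Measure.le_iff'.2 fun A => ?_
  rw [A.measure_eq_iInf_isOpen ν]
  exact le_iInf₂ fun U hAU => le_iInf fun hU => (measure_mono hAU).trans (h U hU)

/-! ### Vanishing divergence -/

theorem IsLiftedPlan.lintegral_add {X Y : Type*} [MeasurableSpace X] [MeasurableSpace Y]
    {μ : Measure X} {ν : Measure Y}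
    {α : Measure ((X × ℝ≥0) × (Y × ℝ≥0))} (hα : IsLiftedPlan μ ν α) :
    ∫⁻ w, ((w.1.2 + w.2.2 : ℝ≥0) : ℝ≥0∞) ∂α = μ univ + ν univ := by
  have h1 := hα.left 1 measurable_one
  have h2 := hα.right 1 measurable_one
  simp only [Pi.one_apply, mul_one, lintegral_one] at h1 h2
  rw [← h1, ← h2, ← lintegral_add_left (by fun_prop)]
  simp

theorem IsLiftedPlan.measure_univ {X Y : Type*} [MeasurableSpace X] [MeasurableSpace Y]
    {μ : Measure X} {ν : Measure Y}
    {α : Measure ((X × ℝ≥0) × (Y × ℝ≥0))} (hα : IsLiftedPlan μ ν α)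
    (hae : ∀ᵐ w ∂α, w.1.2 + w.2.2 = 1) : α univ = μ univ + ν univ := by
  rw [← hα.lintegral_add, ← lintegral_one]
  refine lintegral_congr_ae ?_
  filter_upwards [hae] with w hw
  simp [hw]

section Vanishing

variable {X Y : Type*} [MetricSpace X] [MetricSpace Y] [MeasurableSpace X] [MeasurableSpace Y]

theorem mul_measure_mul_measure_le_energy {K : ℝ≥0 → ℝ≥0 → ℝ≥0 → ℝ≥0 → ℝ≥0∞}
    (β : Measure ((X × ℝ≥0) × (Y × ℝ≥0))) {U V : Set ((X × ℝ≥0) × (Y × ℝ≥0))}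
    (hU : MeasurableSet U) (hV : MeasurableSet V) {c : ℝ≥0∞}
    (h : ∀ w ∈ U, ∀ z ∈ V, c ≤ pairCost K w z) : c * (β U * β V) ≤ energy K β := by
  have h1 : ∀ w, U.indicator (fun _ => c * β V) w ≤ ∫⁻ z, pairCost K w z ∂β := by
    intro w
    by_cases hw : w ∈ U
    · rw [indicator_of_mem hw, ← lintegral_indicator_const hV]
      refine lintegral_mono fun z => ?_
      by_cases hz : z ∈ V
      · simpa [hz] using h w hw z hz
      · simp [hz]
    · simp [hw]
  refine le_trans (le_of_eq ?_) (lintegral_mono h1)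
  rw [lintegral_indicator_const hU]
  ring

/-- By `base_le` it suffices to bound one lower semicontinuous function of `(a, b)` on a compact set
that avoids its zeros, which lie on `a = b`. -/
theorem IsConeKernel.exists_pos_le {K : ℝ≥0 → ℝ≥0 → ℝ≥0 → ℝ≥0 → ℝ≥0∞} (hK : IsConeKernel K)
    {δ : ℝ≥0} (hδ : 0 < δ) :
    ∃ c : ℝ≥0∞, 0 < c ∧ ∀ t u a b, a + δ ≤ b → b ≤ 1 → c ≤ K t u a b := by
  have hlsc : LowerSemicontinuous fun v : ℝ≥0 × ℝ≥0 => K 0 0 v.1 v.2 :=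
    hK.lsc.comp (g := fun v : ℝ≥0 × ℝ≥0 => (((0 : ℝ≥0), (0 : ℝ≥0)), v)) (by fun_prop)
  let C : Set (ℝ≥0 × ℝ≥0) := {v | v.1 + δ ≤ v.2 ∧ v.2 ≤ 1}
  have hC : IsCompact C := by
    refine (isCompact_Icc (a := ((0 : ℝ≥0), (0 : ℝ≥0))) (b := (1, 1))).of_isClosed_subset ?_ ?_
    · exact (isClosed_le (by fun_prop) (by fun_prop)).inter (isClosed_le (by fun_prop) (by fun_prop))
    · rintro v ⟨h1, h2⟩
      exact ⟨⟨zero_le, zero_le⟩, (le_self_add.trans h1).trans h2, h2⟩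
  rcases C.eq_empty_or_nonempty with hE | hne
  · refine ⟨1, one_pos, fun t u a b h1 h2 => ?_⟩
    have : (a, b) ∈ C := ⟨h1, h2⟩
    simp [hE] at this
  · obtain ⟨v, hv, hmin⟩ := LowerSemicontinuousOn.exists_isMinOn hne hC (hlsc.lowerSemicontinuousOn _)
    refine ⟨K 0 0 v.1 v.2, pos_of_ne_zero fun h => ?_, fun t u a b h1 h2 => ?_⟩
    · have h3 := ((hK.eq_zero_iff _ _ _ _).1 h).1
      have h4 : v.1 + δ ≤ v.1 := hv.1.trans_eq h3.symm
      exact absurd h4 (not_le.2 (lt_add_of_pos_right _ hδ))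
    · exact (hmin (a := (a, b)) ⟨h1, h2⟩).trans (hK.base_le t u a b)

theorem IsConeKernel.exists_pos_mul_sq_le {K : ℝ≥0 → ℝ≥0 → ℝ≥0 → ℝ≥0 → ℝ≥0∞}
    (hK : IsConeKernel K) {δ : ℝ≥0} (hδ : 0 < δ) :
    ∃ c : ℝ≥0∞, 0 < c ∧ ∀ β : Measure ((X × ℝ≥0) × (Y × ℝ≥0)),
      (∀ᵐ w ∂β, w.1.2 + w.2.2 = 1) →
      c * β {w | w.1.2 + δ ≤ w.2.2} ^ 2 ≤ energy K β ∧
      c * β {w | w.2.2 + δ ≤ w.1.2} ^ 2 ≤ energy K β := by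
  -- The kernel sees products of weights: two gaps of size `δ` in the same direction leave a gap of
  -- at least `δ * δ` between the products.
  obtain ⟨c, hc, hcK⟩ := hK.exists_pos_le (mul_pos hδ hδ)
  have hprod : ∀ a b a' b' : ℝ≥0, a + δ ≤ b → a' + δ ≤ b' → a * a' + δ * δ ≤ b * b' := by
    intro a b a' b' h1 h2
    calc a * a' + δ * δ ≤ (a + δ) * (a' + δ) := by
          rw [add_mul, mul_add, mul_add]
          calc a * a' + δ * δ ≤ a * a' + δ * δ + (a * δ + δ * a') := le_self_add
            _ = _ := by ring
      _ ≤ b * b' := mul_le_mul' h1 h2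
  refine ⟨c, hc, fun β hβ => ⟨?_, ?_⟩⟩
  · have hm : MeasurableSet {w : (X × ℝ≥0) × (Y × ℝ≥0) | w.1.2 + δ ≤ w.2.2 ∧ w.2.2 ≤ 1} :=
      (measurableSet_le (by fun_prop) (by fun_prop)).inter
        (measurableSet_le (by fun_prop) (by fun_prop))
    have hle : β {w | w.1.2 + δ ≤ w.2.2} ≤ β {w | w.1.2 + δ ≤ w.2.2 ∧ w.2.2 ≤ 1} := by
      refine measure_mono_ae ?_
      filter_upwards [hβ] with w hw h
      exact ⟨h, hw ▸ le_add_self⟩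
    refine le_trans ?_ (mul_measure_mul_measure_le_energy β hm hm (c := c) ?_)
    · rw [sq]; gcongr
    · rintro w ⟨h1, h2⟩ z ⟨h3, h4⟩
      exact hcK _ _ _ _ (hprod _ _ _ _ h1 h3) (mul_le_one' h2 h4)
  · have hm : MeasurableSet {w : (X × ℝ≥0) × (Y × ℝ≥0) | w.2.2 + δ ≤ w.1.2 ∧ w.1.2 ≤ 1} :=
      (measurableSet_le (by fun_prop) (by fun_prop)).inter
        (measurableSet_le (by fun_prop) (by fun_prop))
    have hle : β {w | w.2.2 + δ ≤ w.1.2} ≤ β {w | w.2.2 + δ ≤ w.1.2 ∧ w.1.2 ≤ 1} := by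
      refine measure_mono_ae ?_
      filter_upwards [hβ] with w hw h
      exact ⟨h, hw ▸ le_self_add⟩
    refine le_trans ?_ (mul_measure_mul_measure_le_energy β hm hm (c := c) ?_)
    · rw [sq]; gcongr
    · rintro w ⟨h1, h2⟩ z ⟨h3, h4⟩
      rw [pairCost, hK.symm]
      exact hcK _ _ _ _ (hprod _ _ _ _ h1 h3) (mul_le_one' h2 h4)

variable [BorelSpace X] [BorelSpace Y] [SecondCountableTopology X] [SecondCountableTopology Y]

/-- A plan may be rescaled so that the two weights add up to one. -/
theorem IsLiftedPlan.exists_normalized {K : ℝ≥0 → ℝ≥0 → ℝ≥0 → ℝ≥0 → ℝ≥0∞} (hK : IsConeKernel K)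
    {μ : Measure X} {ν : Measure Y} [IsFiniteMeasure μ] [IsFiniteMeasure ν]
    {α : Measure ((X × ℝ≥0) × (Y × ℝ≥0))} (hα : IsLiftedPlan μ ν α) :
    ∃ β, IsLiftedPlan μ ν β ∧ energy K β = energy K α ∧ ∀ᵐ w ∂β, w.1.2 + w.2.2 = 1 := by
  have hF : Measurable fun w : (X × ℝ≥0) × (Y × ℝ≥0) =>
    ((w.1.1, w.1.2 / (w.1.2 + w.2.2)), (w.2.1, w.2.2 / (w.1.2 + w.2.2))) := by fun_prop
  have hω : Measurable fun w : (X × ℝ≥0) × (Y × ℝ≥0) => w.1.2 + w.2.2 := by fun_prop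
  have h := hα.reweight hK hω hF ?_ ?_ (fun _ _ => rfl) (fun _ _ => rfl)
    (by rw [hα.lintegral_add]; finiteness)
  · refine ⟨_, h.1, h.2, ?_⟩
    rw [ae_map_iff hF.aemeasurable (measurableSet_eq_fun (by fun_prop) (by fun_prop)),
      ae_withDensity_iff (by fun_prop)]
    -- Points with both weights zero have density `0` and disappear, so the division by zero in the
    -- map is harmless.
    refine Eventually.of_forall fun w hw => ?_
    have hw' : w.1.2 + w.2.2 ≠ 0 := by simpa using hw
    change w.1.2 / (w.1.2 + w.2.2) + w.2.2 / (w.1.2 + w.2.2) = 1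
    rw [← add_div, div_self hw']
  · intro w
    by_cases hw : w.1.2 + w.2.2 = 0
    · simp [(add_eq_zero.1 hw).1]
    · exact mul_div_cancel₀ _ hw
  · intro w
    by_cases hw : w.1.2 + w.2.2 = 0
    · simp [(add_eq_zero.1 hw).2]
    · exact mul_div_cancel₀ _ hw

end Vanishing

/-! ### Compactness of balanced plans and the limit coupling. -/

section Limit

variable {X Y : Type*} [MeasurableSpace X] [MeasurableSpace Y]

/-- The part of a plan on which the weights are balanced. -/
def balancedPart (β : Measure ((X × ℝ≥0) × (Y × ℝ≥0))) : Measure ((X × ℝ≥0) × (Y × ℝ≥0)) :=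
  β.withDensity fun w => ((2 * min w.1.2 w.2.2 : ℝ≥0) : ℝ≥0∞)

theorem balancedPart_le {β : Measure ((X × ℝ≥0) × (Y × ℝ≥0))}
    (hae : ∀ᵐ w ∂β, w.1.2 + w.2.2 = 1) : balancedPart β ≤ β := by
  conv_rhs => rw [← withDensity_one (μ := β)]
  refine withDensity_mono ?_
  filter_upwards [hae] with w hw
  rw [Pi.one_apply, ← ENNReal.coe_one, ENNReal.coe_le_coe, ← hw, two_mul]
  exact add_le_add (min_le_left _ _) (min_le_right _ _)

/-- The density is at most `2 a`, and `a` integrates to `μ`. This domination is what makes the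
balanced parts tight. -/
theorem IsLiftedPlan.balancedPart_left_le {μ : Measure X} {ν : Measure Y}
    {β : Measure ((X × ℝ≥0) × (Y × ℝ≥0))} (hβ : IsLiftedPlan μ ν β) {A : Set X}
    (hA : MeasurableSet A) : balancedPart β ((fun w => w.1.1) ⁻¹' A) ≤ 2 * μ A := by
  have hA' : MeasurableSet ((fun w : (X × ℝ≥0) × (Y × ℝ≥0) => w.1.1) ⁻¹' A) :=
    (by fun_prop : Measurable fun w : (X × ℝ≥0) × (Y × ℝ≥0) => w.1.1) hA
  have h := hβ.left (A.indicator fun _ => 2) (measurable_const.indicator hA)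
  rw [lintegral_indicator_const hA] at h
  rw [balancedPart, withDensity_apply _ hA', ← h, ← lintegral_indicator hA']
  refine lintegral_mono fun w => ?_
  by_cases hw : w.1.1 ∈ A
  · rw [indicator_of_mem (by exact hw), indicator_of_mem hw, mul_comm, ENNReal.coe_mul,
      ENNReal.coe_ofNat]
    gcongr
    exact min_le_left _ _
  · rw [indicator_of_notMem (by exact hw)]
    exact zero_le

theorem IsLiftedPlan.balancedPart_right_le {μ : Measure X} {ν : Measure Y}
    {β : Measure ((X × ℝ≥0) × (Y × ℝ≥0))} (hβ : IsLiftedPlan μ ν β) {A : Set Y}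
    (hA : MeasurableSet A) : balancedPart β ((fun w => w.2.1) ⁻¹' A) ≤ 2 * ν A := by
  have hA' : MeasurableSet ((fun w : (X × ℝ≥0) × (Y × ℝ≥0) => w.2.1) ⁻¹' A) :=
    (by fun_prop : Measurable fun w : (X × ℝ≥0) × (Y × ℝ≥0) => w.2.1) hA
  have h := hβ.right (A.indicator fun _ => 2) (measurable_const.indicator hA)
  rw [lintegral_indicator_const hA] at h
  rw [balancedPart, withDensity_apply _ hA', ← h, ← lintegral_indicator hA']
  refine lintegral_mono fun w => ?_
  by_cases hw : w.2.1 ∈ A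
  · rw [indicator_of_mem (by exact hw), indicator_of_mem hw, mul_comm, ENNReal.coe_mul,
      ENNReal.coe_ofNat]
    gcongr
    exact min_le_right _ _
  · rw [indicator_of_notMem (by exact hw)]
    exact zero_le

/-- Where the weights differ by less than `δ`, `1 = a + b ≤ 2 min(a, b) + δ`; the other points lie
in the last two sets. -/
theorem measure_univ_le_balancedPart {β : Measure ((X × ℝ≥0) × (Y × ℝ≥0))}
    (hae : ∀ᵐ w ∂β, w.1.2 + w.2.2 = 1) (δ : ℝ≥0) :
    β univ ≤ balancedPart β univ + δ * β univ + β {w | w.1.2 + δ ≤ w.2.2} +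
      β {w | w.2.2 + δ ≤ w.1.2} := by
  have hL : MeasurableSet {w : (X × ℝ≥0) × (Y × ℝ≥0) | w.1.2 + δ ≤ w.2.2} :=
    measurableSet_le (by fun_prop) (by fun_prop)
  have hR : MeasurableSet {w : (X × ℝ≥0) × (Y × ℝ≥0) | w.2.2 + δ ≤ w.1.2} :=
    measurableSet_le (by fun_prop) (by fun_prop)
  rw [balancedPart, withDensity_apply _ MeasurableSet.univ, Measure.restrict_univ,
    ← lintegral_const, ← lintegral_indicator_one hL, ← lintegral_indicator_one hR,
    ← lintegral_add_left (by fun_prop), ← lintegral_add_right _ (measurable_one.indicator hL),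
    ← lintegral_add_right _ (measurable_one.indicator hR), ← lintegral_one]
  refine lintegral_mono_ae ?_
  filter_upwards [hae] with w hw
  by_cases h1 : w.1.2 + δ ≤ w.2.2
  · rw [indicator_of_mem (by exact h1)]
    exact (le_add_left le_rfl).trans le_self_add
  by_cases h2 : w.2.2 + δ ≤ w.1.2
  · rw [indicator_of_mem (s := {w : (X × ℝ≥0) × (Y × ℝ≥0) | w.2.2 + δ ≤ w.1.2}) (by exact h2)]
    exact le_add_left le_rfl
  · refine le_trans ?_ (le_self_add.trans le_self_add)
    rw [← ENNReal.coe_add, ← ENNReal.coe_one, ENNReal.coe_le_coe, ← hw]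
    push Not at h1 h2
    rcases le_total w.1.2 w.2.2 with h | h
    · rw [min_eq_left h, two_mul, add_assoc]
      gcongr
    · rw [min_eq_right h, two_mul, add_comm, add_assoc]
      gcongr

variable [MetricSpace X] [MetricSpace Y] [BorelSpace X] [BorelSpace Y]
  [SecondCountableTopology X] [SecondCountableTopology Y] [CompleteSpace X] [CompleteSpace Y]

theorem exists_isCompact_measure_compl_le (μ : Measure X) [IsFiniteMeasure μ] {ε : ℝ≥0∞}
    (hε : 0 < ε) : ∃ C : Set X, IsCompact C ∧ μ Cᶜ ≤ ε := by
  obtain ⟨C, hC, h⟩ := isTightMeasureSet_iff_exists_isCompact_measure_compl_le.1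
    (isTightMeasureSet_singleton (μ := μ)) ε hε
  exact ⟨C, hC, h μ rfl⟩

/-- Balanced parts of normalized plans have a weak limit along every ultrafilter. -/
theorem exists_tendsto_balancedPart {μ : Measure X} {ν : Measure Y} [IsFiniteMeasure μ]
    [IsFiniteMeasure ν] {β : ℕ → Measure ((X × ℝ≥0) × (Y × ℝ≥0))}
    (hβ : ∀ n, IsLiftedPlan μ ν (β n)) (hae : ∀ n, ∀ᵐ w ∂β n, w.1.2 + w.2.2 = 1)
    (F : Ultrafilter ℕ) :
    ∃ (r : ℕ → FiniteMeasure ((X × ℝ≥0) × (Y × ℝ≥0)))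
      (ρ : FiniteMeasure ((X × ℝ≥0) × (Y × ℝ≥0))),
      (∀ n, (r n : Measure ((X × ℝ≥0) × (Y × ℝ≥0))) = balancedPart (β n)) ∧ Tendsto r F (𝓝 ρ) := by
  have hfin : ∀ n, IsFiniteMeasure (balancedPart (β n)) := fun n => by
    have := (hβ n).finite
    exact isFiniteMeasure_of_le _ (balancedPart_le (hae n))
  let r : ℕ → FiniteMeasure ((X × ℝ≥0) × (Y × ℝ≥0)) := fun n => ⟨balancedPart (β n), hfin n⟩
  have hu : ∀ k : ℕ, (0 : ℝ≥0∞) < ((1 / (k + 1) : ℝ≥0) : ℝ≥0∞) := fun k => by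
    simp only [ENNReal.coe_pos]; positivity
  choose C1 hC1 hμ using fun k => exists_isCompact_measure_compl_le μ (hu k)
  choose C2 hC2 hν using fun k => exists_isCompact_measure_compl_le ν (hu k)
  let C : ℕ → Set ((X × ℝ≥0) × (Y × ℝ≥0)) := fun k =>
    (C1 k ×ˢ Icc 0 1) ×ˢ (C2 k ×ˢ Icc 0 1)
  have hC : ∀ k, IsCompact (C k) := fun k =>
    ((hC1 k).prod isCompact_Icc).prod ((hC2 k).prod isCompact_Icc)
  -- The domination by `2 μ` and `2 ν` costs at most `2 / (k + 1)` outside each of `C1 k` and `C2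
  -- k`, hence the `4`.
  have hlim : Tendsto (fun k : ℕ => (4 * (1 / (k + 1)) : ℝ≥0)) atTop (𝓝 0) := by
    rw [← NNReal.tendsto_coe]
    simpa using (tendsto_one_div_add_atTop_nhds_zero_nat (𝕜 := ℝ)).const_mul (4 : ℝ)
  have hcomp := isCompact_setOfPred_finiteMeasure_mass_le_compl_isCompact_le
    (E := (X × ℝ≥0) × (Y × ℝ≥0)) (u := fun k : ℕ => (4 * (1 / (k + 1)) : ℝ≥0)) (K := C)
    (μ univ + ν univ).toNNReal hlim hC (Or.inl inferInstance)
  have hmem : ∀ n, r n ∈ {ρ : FiniteMeasure ((X × ℝ≥0) × (Y × ℝ≥0)) |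
      ρ.mass ≤ (μ univ + ν univ).toNNReal ∧ ∀ k : ℕ, ρ (C k)ᶜ ≤ 4 * (1 / (k + 1))} := by
    intro n
    refine ⟨?_, fun k => ?_⟩
    · rw [← ENNReal.coe_le_coe, ENNReal.coe_toNNReal (by finiteness),
        FiniteMeasure.ennreal_mass, ← (hβ n).measure_univ (hae n)]
      exact balancedPart_le (hae n) univ
    · rw [← ENNReal.coe_le_coe, FiniteMeasure.ennreal_coeFn_eq_coeFn_toMeasure]
      change balancedPart (β n) (C k)ᶜ ≤ _
      have hac : balancedPart (β n) {w | ¬ (w.1.2 + w.2.2 = 1)} = 0 :=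
        le_antisymm ((balancedPart_le (hae n) _).trans_eq (hae n)) zero_le
      have hsub : (C k)ᶜ ⊆ ((fun w : (X × ℝ≥0) × (Y × ℝ≥0) => w.1.1) ⁻¹' (C1 k)ᶜ ∪
          (fun w : (X × ℝ≥0) × (Y × ℝ≥0) => w.2.1) ⁻¹' (C2 k)ᶜ) ∪
          {w | ¬ (w.1.2 + w.2.2 = 1)} := by
        intro w hw
        by_contra hcon
        simp only [mem_union, mem_preimage, mem_compl_iff, mem_ofPred_eq, not_or, not_not] at hcon
        obtain ⟨⟨h1, h2⟩, h3⟩ := hcon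
        exact hw ⟨⟨h1, zero_le, h3 ▸ le_self_add⟩, h2, zero_le, h3 ▸ le_add_self⟩
      refine (measure_mono hsub).trans ((measure_union_le _ _).trans ?_)
      rw [hac, add_zero]
      refine (measure_union_le _ _).trans ?_
      refine (add_le_add ((hβ n).balancedPart_left_le (hC1 k).measurableSet.compl)
        ((hβ n).balancedPart_right_le (hC2 k).measurableSet.compl)).trans ?_
      refine (add_le_add (mul_le_mul_right (hμ k) 2) (mul_le_mul_right (hν k) 2)).trans
        (le_of_eq ?_)
      rw [← add_mul, ENNReal.coe_mul]
      norm_num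
  obtain ⟨ρ, -, hρ⟩ := hcomp.ultrafilter_le_nhds (F.map r)
    (le_principal_iff.2 (mem_map.2 (univ_mem' hmem)))
  exact ⟨r, ρ, fun _ => rfl, hρ⟩

/-- Plans with arbitrarily small energy accumulate at a coupling that preserves distances. -/
theorem IsConeKernel.exists_isometric_coupling {K : ℝ≥0 → ℝ≥0 → ℝ≥0 → ℝ≥0 → ℝ≥0∞}
    (hK : IsConeKernel K) {μ : Measure X} {ν : Measure Y} [IsFiniteMeasure μ] [IsFiniteMeasure ν]
    (h : ∀ ε : ℝ≥0∞, 0 < ε → ∃ α, IsLiftedPlan μ ν α ∧ energy K α < ε) :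
    ∃ γ : Measure ((X × ℝ≥0) × (Y × ℝ≥0)), γ.map (fun w => w.1.1) = μ ∧
      γ.map (fun w => w.2.1) = ν ∧ ∀ w ∈ γ.support, ∀ z ∈ γ.support,
        w.1.2 = z.1.2 ∧ w.2.2 = z.2.2 ∧ nndist w.1.1 z.1.1 = nndist w.2.1 z.2.1 := by
  have hseq : ∀ n : ℕ, ∃ β, IsLiftedPlan μ ν β ∧ energy K β ≤ ((n : ℝ≥0∞) + 1)⁻¹ ∧
      ∀ᵐ w ∂β, w.1.2 + w.2.2 = 1 := fun n => by
    obtain ⟨α, hα, hε⟩ := h ((n : ℝ≥0∞) + 1)⁻¹ (by simp)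
    obtain ⟨β, hβ, he, hae⟩ := hα.exists_normalized hK
    exact ⟨β, hβ, he ▸ hε.le, hae⟩
  choose β hβ hen hae using hseq
  -- A nonprincipal ultrafilter replaces the extraction of a subsequence.
  obtain ⟨r, ρ, hr, hlim⟩ := exists_tendsto_balancedPart hβ hae (hyperfilter ℕ)
  set F : Ultrafilter ℕ := hyperfilter ℕ with hF
  have hFle : (F : Filter ℕ) ≤ atTop := Nat.hyperfilter_le_atTop
  have henergy : Tendsto (fun n => energy K (β n)) F (𝓝 0) := by
    refine Tendsto.mono_left ?_ hFle
    refine tendsto_of_tendsto_of_tendsto_of_le_of_le tendsto_const_nhds ?_ (fun _ => zero_le) hen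
    have := (tendsto_add_atTop_iff_nat 1).2 ENNReal.tendsto_inv_nat_nhds_zero
    simpa using this
  set m : ℝ≥0∞ := μ univ + ν univ with hm
  have hmtop : m ≠ ∞ := by rw [hm]; finiteness
  -- the limit has full mass
  have hsmall : ∀ (A : Set ((X × ℝ≥0) × (Y × ℝ≥0))) (c : ℝ≥0∞), 0 < c →
      (∀ n, c * β n A ^ 2 ≤ energy K (β n)) → Tendsto (fun n => β n A) F (𝓝 0) := by
    intro A c hc hA
    refine ENNReal.tendsto_nhds_zero.2 fun ε hε => ?_
    have hpos : 0 < c * ε ^ 2 := ENNReal.mul_pos hc.ne' (pow_ne_zero 2 hε.ne')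
    filter_upwards [henergy.eventually_lt_const hpos] with n hn
    by_contra! hcon
    refine absurd ((hA n).trans_lt hn) (not_lt.2 ?_)
    gcongr
  have hmass : Tendsto (fun n => (r n : Measure ((X × ℝ≥0) × (Y × ℝ≥0))) univ) F
      (𝓝 ((ρ : Measure ((X × ℝ≥0) × (Y × ℝ≥0))) univ)) := by
    have := ENNReal.tendsto_coe.2 hlim.mass
    simpa only [FiniteMeasure.ennreal_mass] using this
  have hfull : m ≤ (ρ : Measure ((X × ℝ≥0) × (Y × ℝ≥0))) univ := by
    have hδ : ∀ δ : ℝ≥0, 0 < δ → m ≤ (ρ : Measure ((X × ℝ≥0) × (Y × ℝ≥0))) univ + δ * m := by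
      intro δ hδ
      obtain ⟨c, hc, hcβ⟩ := hK.exists_pos_mul_sq_le (X := X) (Y := Y) hδ
      have h1 := hsmall _ c hc fun n => (hcβ (β n) (hae n)).1
      have h2 := hsmall _ c hc fun n => (hcβ (β n) (hae n)).2
      have h3 := ((hmass.add_const (δ * m)).add h1).add h2
      rw [add_zero, add_zero] at h3
      refine ge_of_tendsto' h3 fun n => ?_
      have h4 := measure_univ_le_balancedPart (hae n) δ
      rwa [(hβ n).measure_univ (hae n), ← hr n] at h4
    have hlim0 : Tendsto (fun δ : ℝ≥0 => (ρ : Measure ((X × ℝ≥0) × (Y × ℝ≥0))) univ + δ * m) (𝓝[>] 0)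
        (𝓝 ((ρ : Measure ((X × ℝ≥0) × (Y × ℝ≥0))) univ + ((0 : ℝ≥0) : ℝ≥0∞) * m)) := by
      refine Tendsto.mono_left ?_ nhdsWithin_le_nhds
      refine tendsto_const_nhds.add (ENNReal.Tendsto.mul_const ?_ (Or.inr hmtop))
      exact ENNReal.tendsto_coe.2 tendsto_id
    rw [ENNReal.coe_zero, zero_mul, add_zero] at hlim0
    exact ge_of_tendsto hlim0 (eventually_nhdsWithin_of_forall fun δ hδ' => hδ δ hδ')
  -- its marginals
  have hopen : ∀ (U : Set ((X × ℝ≥0) × (Y × ℝ≥0))) (C : ℝ≥0∞), IsOpen U →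
      (∀ n, balancedPart (β n) U ≤ C) → (ρ : Measure ((X × ℝ≥0) × (Y × ℝ≥0))) U ≤ C := by
    intro U C hU hC
    refine le_of_forall_lt fun y hy => ?_
    obtain ⟨n, hn⟩ := (eventually_lt_measure_of_isOpen hlim hU hy).exists
    exact hn.trans_le (hr n ▸ hC n)
  have hc1 : Continuous fun w : (X × ℝ≥0) × (Y × ℝ≥0) => w.1.1 := by fun_prop
  have hc2 : Continuous fun w : (X × ℝ≥0) × (Y × ℝ≥0) => w.2.1 := by fun_prop
  have hle1 : (ρ : Measure ((X × ℝ≥0) × (Y × ℝ≥0))).map (fun w => w.1.1) ≤ (2 : ℝ≥0) • μ := by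
    refine measure_le_of_forall_isOpen fun U hU => ?_
    rw [Measure.map_apply hc1.measurable hU.measurableSet]
    exact hopen _ _ (hU.preimage hc1) fun n => (hβ n).balancedPart_left_le hU.measurableSet
  have hle2 : (ρ : Measure ((X × ℝ≥0) × (Y × ℝ≥0))).map (fun w => w.2.1) ≤ (2 : ℝ≥0) • ν := by
    refine measure_le_of_forall_isOpen fun U hU => ?_
    rw [Measure.map_apply hc2.measurable hU.measurableSet]
    exact hopen _ _ (hU.preimage hc2) fun n => (hβ n).balancedPart_right_le hU.measurableSet
  -- The bounds `μ(X) + ν(Y) ≤ 2 μ(X)` and `≤ 2 ν(Y)` force equal total masses, and then both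
  -- dominations are equalities.
  have hm1 : m ≤ 2 * μ univ := by
    refine hfull.trans (le_trans (le_of_eq ?_) (hle1 univ))
    rw [Measure.map_apply hc1.measurable MeasurableSet.univ, preimage_univ]
  have hm2 : m ≤ 2 * ν univ := by
    refine hfull.trans (le_trans (le_of_eq ?_) (hle2 univ))
    rw [Measure.map_apply hc2.measurable MeasurableSet.univ, preimage_univ]
  have hμν : μ univ = ν univ := by
    rw [hm, two_mul] at hm1 hm2
    exact le_antisymm ((ENNReal.add_le_add_iff_right (by finiteness)).1 hm2)
      ((ENNReal.add_le_add_iff_left (by finiteness)).1 hm1)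
  have hmap1 : (ρ : Measure ((X × ℝ≥0) × (Y × ℝ≥0))).map (fun w => w.1.1) = (2 : ℝ≥0) • μ := by
    refine Measure.eq_of_le_of_measure_univ_eq hle1 (le_antisymm (hle1 univ) ?_)
    rw [Measure.map_apply hc1.measurable MeasurableSet.univ, preimage_univ]
    refine le_trans (le_of_eq ?_) hfull
    rw [hm, ← hμν, ← two_mul]
    rfl
  have hmap2 : (ρ : Measure ((X × ℝ≥0) × (Y × ℝ≥0))).map (fun w => w.2.1) = (2 : ℝ≥0) • ν := by
    refine Measure.eq_of_le_of_measure_univ_eq hle2 (le_antisymm (hle2 univ) ?_)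
    rw [Measure.map_apply hc2.measurable MeasurableSet.univ, preimage_univ]
    refine le_trans (le_of_eq ?_) hfull
    rw [hm, hμν, ← two_mul]
    rfl
  -- the cost vanishes on the support
  have hzero : ∀ w ∈ (ρ : Measure ((X × ℝ≥0) × (Y × ℝ≥0))).support, ∀ z ∈ (ρ : Measure ((X × ℝ≥0) × (Y × ℝ≥0))).support,
      pairCost K w z = 0 := by
    intro w hw z hz
    -- Otherwise the cost exceeds some `e > 0` on a product of neighbourhoods. The limit charges
    -- both, so the approximating plans charge them too, and their energy stays away from `0`.
    by_contra hne
    obtain ⟨e, he0, he⟩ := exists_between (pos_of_ne_zero hne)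
    have hnhds := hK.lowerSemicontinuous_pairCost (w, z) e he
    rw [nhds_prod_eq, eventually_prod_iff] at hnhds
    obtain ⟨P, hP, Q, hQ, hPQ⟩ := hnhds
    obtain ⟨U, hUP, hU, hwU⟩ := mem_nhds_iff.1 hP
    obtain ⟨V, hVQ, hV, hzV⟩ := mem_nhds_iff.1 hQ
    obtain ⟨y1, hy1, hyU⟩ := exists_between
      ((Measure.mem_support_iff_forall w).1 hw U (hU.mem_nhds hwU))
    obtain ⟨y2, hy2, hyV⟩ := exists_between
      ((Measure.mem_support_iff_forall z).1 hz V (hV.mem_nhds hzV))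
    have hpos : 0 < e * (y1 * y2) := ENNReal.mul_pos he0.ne' (mul_ne_zero hy1.ne' hy2.ne')
    obtain ⟨n, ⟨hn1, hn2⟩, hn3⟩ := (((eventually_lt_measure_of_isOpen hlim hU hyU).and
      (eventually_lt_measure_of_isOpen hlim hV hyV)).and
      (henergy.eventually_lt_const hpos)).exists
    refine absurd hn3 (not_lt.2 ?_)
    refine le_trans ?_ (mul_measure_mul_measure_le_energy (β n) hU.measurableSet hV.measurableSet
      (c := e) fun a ha b hb => (hPQ (hUP ha) (hVQ hb)).le)
    have hb := balancedPart_le (hae n)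
    rw [← hr n] at hb
    gcongr
    · exact hn1.le.trans (hb U)
    · exact hn2.le.trans (hb V)
  have hone : ∀ w ∈ (ρ : Measure ((X × ℝ≥0) × (Y × ℝ≥0))).support, w.1.2 + w.2.2 = 1 := by
    have hcl : IsClosed {w : (X × ℝ≥0) × (Y × ℝ≥0) | w.1.2 + w.2.2 = 1} :=
      isClosed_eq (by fun_prop) (by fun_prop)
    refine fun w hw => Measure.support_subset_of_isClosed hcl ?_ hw
    rw [mem_ae_iff]
    refine le_antisymm (hopen _ 0 hcl.isOpen_compl fun n => ?_) zero_le
    exact (balancedPart_le (hae n) _).trans_eq (hae n)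
  have hhalf : ∀ w ∈ (ρ : Measure ((X × ℝ≥0) × (Y × ℝ≥0))).support, w.1.2 = 2⁻¹ ∧ w.2.2 = 2⁻¹ := by
    intro w hw
    -- Pairing `w` with itself compares the squares of its two weights.
    have h1 := ((hK.eq_zero_iff _ _ _ _).1 (hzero w hw w hw)).1
    have h2 : w.1.2 = w.2.2 := mul_self_inj zero_le zero_le |>.1 h1
    have h3 := hone w hw
    rw [← h2, ← two_mul] at h3
    have h4 : w.1.2 = 2⁻¹ := eq_inv_of_mul_eq_one_right h3
    exact ⟨h4, h2 ▸ h4⟩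
  -- The factor undoes the `2` in the density of `balancedPart`.
  refine ⟨(2⁻¹ : ℝ≥0) • (ρ : Measure ((X × ℝ≥0) × (Y × ℝ≥0))), ?_, ?_, ?_⟩
  · rw [Measure.map_smul, hmap1, smul_smul, inv_mul_cancel₀ two_ne_zero, one_smul]
  · rw [Measure.map_smul, hmap2, smul_smul, inv_mul_cancel₀ two_ne_zero, one_smul]
  · have hsupp : ((2⁻¹ : ℝ≥0) • (ρ : Measure ((X × ℝ≥0) × (Y × ℝ≥0)))).support ⊆
        (ρ : Measure ((X × ℝ≥0) × (Y × ℝ≥0))).support :=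
      Measure.AbsolutelyContinuous.support_mono (Measure.smul_absolutelyContinuous)
    intro w hw z hz
    have hw' := hhalf w (hsupp hw)
    have hz' := hhalf z (hsupp hz)
    refine ⟨hw'.1.trans hz'.1.symm, hw'.2.trans hz'.2.symm, ?_⟩
    have h1 := ((hK.eq_zero_iff _ _ _ _).1 (hzero w (hsupp hw) z (hsupp hz))).2
    refine h1.resolve_left ?_
    rw [hw'.1, hz'.1]
    norm_num

end Limit

/-- The weights are constant on the support of the coupling, so the sup distance of the product
reduces there to the common distance in `X` and `Y`. Both projections are thus isometries, and they
compose through `γ.support`. -/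
theorem IsConeKernel.isometric {K : ℝ≥0 → ℝ≥0 → ℝ≥0 → ℝ≥0 → ℝ≥0∞} (hK : IsConeKernel K)
    {X Y : MMSpace.{u}}
    (h : ∀ ε : ℝ≥0∞, 0 < ε → ∃ α, IsLiftedPlan X.meas Y.meas α ∧ energy K α < ε) :
    MMSpace.Isometric X Y := by
  obtain ⟨γ, h1, h2, hd⟩ := hK.exists_isometric_coupling h
  have hdist : ∀ w ∈ γ.support, ∀ z ∈ γ.support,
      dist w.1.1 z.1.1 = dist w z ∧ dist w.2.1 z.2.1 = dist w z := by
    intro w hw z hz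
    obtain ⟨e1, e2, e3⟩ := hd w hw z hz
    have e3' : dist w.1.1 z.1.1 = dist w.2.1 z.2.1 := congrArg NNReal.toReal e3
    have : dist w z = dist w.2.1 z.2.1 := by
      rw [Prod.dist_eq, Prod.dist_eq, Prod.dist_eq, e1, e2, e3']
      simp
    exact ⟨e3'.trans this.symm, this.symm⟩
  obtain ⟨e, he⟩ := exists_isometryEquiv_support (f := fun w => w.1.1) (by fun_prop) h1
    fun w hw z hz => (hdist w hw z hz).1
  obtain ⟨e', he'⟩ := exists_isometryEquiv_support (f := fun w => w.2.1) (by fun_prop) h2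
    fun w hw z hz => (hdist w hw z hz).2
  refine ⟨e.symm.trans e', ?_⟩
  rw [← he, ← he', Measure.map_map (e.symm.trans e').continuous.measurable
    e.continuous.measurable]
  congr 1
  funext w
  simp

/-! ### Gluing and the triangle inequality -/

section Glue

open ProbabilityTheory

/-- Gluing of two measures along a common marginal. -/
theorem exists_glue {A B C : Type*} [MeasurableSpace A] [MeasurableSpace B] [MeasurableSpace C]
    [StandardBorelSpace A] [StandardBorelSpace C] [Nonempty A] [Nonempty C]
    (α : Measure (A × B)) (β : Measure (B × C)) [IsFiniteMeasure α] [IsFiniteMeasure β]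
    (h : α.map Prod.snd = β.map Prod.fst) :
    ∃ Γ : Measure (B × (A × C)), IsFiniteMeasure Γ ∧ Γ.map (fun t => (t.2.1, t.1)) = α ∧
      Γ.map (fun t => (t.1, t.2.2)) = β := by
  let α' : Measure (B × A) := α.map Prod.swap
  have hα' : α'.fst = β.fst := by
    rw [Measure.fst, Measure.map_map measurable_fst measurable_swap]
    exact h
  -- The two outer coordinates are drawn independently given the one in `B`.
  let κ : Kernel B (A × C) := α'.condKernel ×ₖ β.condKernel
  have h1 : (β.fst ⊗ₘ κ).map (Prod.map id Prod.fst) = α' := by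
    rw [← Measure.compProd_map measurable_fst, ← Kernel.fst_eq, Kernel.fst_prod, ← hα', Measure.disintegrate]
  have h2 : (β.fst ⊗ₘ κ).map (Prod.map id Prod.snd) = β := by
    rw [← Measure.compProd_map measurable_snd, ← Kernel.snd_eq, Kernel.snd_prod, Measure.disintegrate]
  refine ⟨β.fst ⊗ₘ κ, inferInstance, ?_, h2⟩
  have h3 : α'.map Prod.swap = α := by
    rw [Measure.map_map measurable_swap measurable_swap, Prod.swap_swap_eq, Measure.map_id]
  rw [← h3, ← h1, Measure.map_map measurable_swap (measurable_id.prodMap measurable_fst)]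
  rfl

end Glue

section Triangle

variable {X Y Z : Type*} [MetricSpace X] [MetricSpace Y] [MetricSpace Z] [MeasurableSpace X]
  [MeasurableSpace Y] [MeasurableSpace Z] [BorelSpace X] [BorelSpace Y] [BorelSpace Z]
  [SecondCountableTopology X] [SecondCountableTopology Y] [SecondCountableTopology Z]

/-- Mass at the pair of apexes changes neither the constraints nor the energy. -/
theorem IsLiftedPlan.add_apex {K : ℝ≥0 → ℝ≥0 → ℝ≥0 → ℝ≥0 → ℝ≥0∞} (hK : IsConeKernel K)
    {μ : Measure X} {ν : Measure Y} {α : Measure ((X × ℝ≥0) × (Y × ℝ≥0))}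
    (hα : IsLiftedPlan μ ν α) (x₀ : X) (y₀ : Y) {c : ℝ≥0∞} (hc : c ≠ ∞) :
    IsLiftedPlan μ ν (α + c • Measure.dirac ((x₀, 0), (y₀, 0))) ∧
      energy K (α + c • Measure.dirac ((x₀, 0), (y₀, 0))) = energy K α := by
  have := hα.finite
  have hfin : IsFiniteMeasure (c • Measure.dirac (((x₀, 0), (y₀, 0)) : (X × ℝ≥0) × (Y × ℝ≥0))) :=
    Measure.smul_finite _ hc
  have hz : ∀ w : (X × ℝ≥0) × (Y × ℝ≥0), pairCost K w ((x₀, 0), (y₀, 0)) = 0 := fun w =>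
    (hK.eq_zero_iff _ _ _ _).2 (by simp)
  have hz' : ∀ w : (X × ℝ≥0) × (Y × ℝ≥0), pairCost K ((x₀, 0), (y₀, 0)) w = 0 := fun w =>
    (hK.eq_zero_iff _ _ _ _).2 (by simp)
  refine ⟨⟨inferInstance, fun f hf => ?_, fun f hf => ?_⟩, ?_⟩
  · rw [lintegral_add_measure, lintegral_smul_measure, lintegral_dirac' _ (by fun_prop),
      hα.left f hf]
    simp
  · rw [lintegral_add_measure, lintegral_smul_measure, lintegral_dirac' _ (by fun_prop),
      hα.right f hf]
    simp
  · have hinner : ∀ w : (X × ℝ≥0) × (Y × ℝ≥0),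
        ∫⁻ z, pairCost K w z ∂(α + c • Measure.dirac ((x₀, 0), (y₀, 0))) =
          ∫⁻ z, pairCost K w z ∂α := fun w => by
      have hm : Measurable fun z => pairCost K w z :=
        hK.measurable_pairCost.comp measurable_prodMk_left
      rw [lintegral_add_measure, lintegral_smul_measure, lintegral_dirac' _ hm, hz]
      simp
    have hm : Measurable fun w : (X × ℝ≥0) × (Y × ℝ≥0) => ∫⁻ z, pairCost K w z ∂α :=
      hK.measurable_pairCost.lintegral_prod_right'
    simp only [energy, hinner]
    rw [lintegral_add_measure, lintegral_smul_measure, lintegral_dirac' _ hm]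
    simp [hz']

/-- A plan may be rescaled so that its second marginal is carried by `Y × {1}` and a point
`(y₀, 0)`, with any sufficiently large mass at this point. -/
theorem IsLiftedPlan.exists_right_normalized {K : ℝ≥0 → ℝ≥0 → ℝ≥0 → ℝ≥0 → ℝ≥0∞}
    (hK : IsConeKernel K) {μ : Measure X} {ν : Measure Y} [IsFiniteMeasure ν]
    {α : Measure ((X × ℝ≥0) × (Y × ℝ≥0))} (hα : IsLiftedPlan μ ν α) (x₀ : X) (y₀ : Y) :
    ∃ M : ℝ≥0∞, M ≠ ∞ ∧ ∀ c : ℝ≥0∞, c ≠ ∞ → ∃ β, IsLiftedPlan μ ν β ∧ energy K β = energy K α ∧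
      β.map Prod.snd = ν.map (fun y => (y, (1 : ℝ≥0))) + (M + c) • Measure.dirac (y₀, 0) := by
  have := hα.finite
  set Z₀ : Set ((X × ℝ≥0) × (Y × ℝ≥0)) := {w | w.2.2 = 0} with hZ₀
  have hZm : MeasurableSet Z₀ := measurableSet_eq_fun (by fun_prop) (by fun_prop)
  set ω : (X × ℝ≥0) × (Y × ℝ≥0) → ℝ≥0 := fun w => if w.2.2 = 0 then 1 else w.2.2 with hω
  -- A positive second weight is divided by itself and becomes `1`; a zero one stays, with its base
  -- point moved to `y₀`. The latter mass, `α Z₀`, is the `M` of the statement.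
  set F : (X × ℝ≥0) × (Y × ℝ≥0) → (X × ℝ≥0) × (Y × ℝ≥0) := fun w =>
    if w.2.2 = 0 then (w.1, (y₀, 0)) else ((w.1.1, w.1.2 / w.2.2), (w.2.1, 1)) with hF
  have hωm : Measurable ω := Measurable.ite hZm (by fun_prop) (by fun_prop)
  have hFm : Measurable F := Measurable.ite hZm (by fun_prop) (by fun_prop)
  have hωfin : ∫⁻ w, ω w ∂α ≠ ∞ := by
    have hle : ∫⁻ w, ω w ∂α ≤ ∫⁻ w, ((1 : ℝ≥0∞) + w.2.2) ∂α := by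
      refine lintegral_mono fun w => ?_
      simp only [hω]
      split_ifs
      · simp
      · exact le_add_self
    have h2 := hα.right 1 measurable_one
    simp only [Pi.one_apply, mul_one, lintegral_one] at h2
    rw [lintegral_add_left measurable_const, h2, lintegral_one] at hle
    exact ne_top_of_le_ne_top (by finiteness) hle
  obtain ⟨hβ, hen⟩ := hα.reweight hK hωm hFm
    (fun w => by
      by_cases h : w.2.2 = 0
      · simp [hω, hF, h]
      · simp only [hω, hF, h, if_false]
        exact mul_div_cancel₀ _ h)
    (fun w => by by_cases h : w.2.2 = 0 <;> simp [hω, hF, h])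
    (fun w _ => by by_cases h : w.2.2 = 0 <;> simp [hF, h])
    (fun w h => by simp [hF, h]) hωfin
  have hsnd : ((α.withDensity fun w => (ω w : ℝ≥0∞)).map F).map Prod.snd =
      ν.map (fun y => (y, (1 : ℝ≥0))) + α Z₀ • Measure.dirac (y₀, 0) := by
    refine Measure.ext_of_lintegral _ fun f hf => ?_
    rw [lintegral_map hf measurable_snd, lintegral_map_withDensity α hωm hFm (by fun_prop),
      lintegral_add_measure, lintegral_map hf (by fun_prop), lintegral_smul_measure,
      lintegral_dirac' _ hf, ← hα.right _ (by fun_prop), smul_eq_mul, mul_comm (α Z₀),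
      ← lintegral_indicator_const hZm, ← lintegral_add_left (by fun_prop)]
    refine lintegral_congr fun w => ?_
    by_cases h : w.2.2 = 0
    · have : w ∈ Z₀ := h
      simp [hω, hF, h, this]
    · have : w ∉ Z₀ := h
      simp [hω, hF, h, this]
  refine ⟨α Z₀, by finiteness, fun c hc => ?_⟩
  obtain ⟨h1, h2⟩ := hβ.add_apex hK x₀ y₀ hc
  refine ⟨_, h1, h2.trans hen, ?_⟩
  rw [Measure.map_add _ _ measurable_snd, hsnd, Measure.map_smul,
    Measure.map_dirac' measurable_snd, add_smul, add_assoc]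

variable [CompleteSpace X] [CompleteSpace Z]

theorem IsLiftedPlan.exists_comp {K : ℝ≥0 → ℝ≥0 → ℝ≥0 → ℝ≥0 → ℝ≥0∞} (hK : IsConeKernel K)
    {q : ℝ} (hq : 1 ≤ q)
    (htri : ∀ t u v a b e : ℝ≥0,
      K t v a e ^ (1 / q) ≤ K t u a b ^ (1 / q) + K u v b e ^ (1 / q))
    [Nonempty X] [Nonempty Y] [Nonempty Z] {μ : Measure X} {ν : Measure Y} {ρ : Measure Z}
    [IsFiniteMeasure ν] {α : Measure ((X × ℝ≥0) × (Y × ℝ≥0))}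
    {β : Measure ((Y × ℝ≥0) × (Z × ℝ≥0))} (hα : IsLiftedPlan μ ν α) (hβ : IsLiftedPlan ν ρ β) :
    ∃ γ, IsLiftedPlan μ ρ γ ∧
      energy K γ ^ (1 / q) ≤ energy K α ^ (1 / q) + energy K β ^ (1 / q) := by
  obtain ⟨x₀⟩ := ‹Nonempty X›
  obtain ⟨y₀⟩ := ‹Nonempty Y›
  obtain ⟨z₀⟩ := ‹Nonempty Z›
  obtain ⟨M, hM, h1⟩ := hα.exists_right_normalized hK x₀ y₀
  obtain ⟨N, hN, h2⟩ := (hβ.swap hK).1.exists_right_normalized hK z₀ y₀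
  -- Each plan receives the apex mass of the other, so that both marginals over `Y` have the atom `M
  -- + N` at `(y₀, 0)` and coincide.
  obtain ⟨α', hα', hEα, hmα⟩ := h1 N hN
  obtain ⟨β', hβ', hEβ, hmβ⟩ := h2 M hM
  obtain ⟨hβ'', hEβ'⟩ := hβ'.swap hK
  have := hα'.finite
  have := hβ''.finite
  obtain ⟨Γ, hΓ, hΓ1, hΓ2⟩ := exists_glue α' (β'.map Prod.swap) (by
    rw [Measure.map_map measurable_fst measurable_swap]
    change α'.map Prod.snd = β'.map Prod.snd
    rw [hmα, hmβ, add_comm M])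
  have hm1 : Measurable fun t : (Y × ℝ≥0) × ((X × ℝ≥0) × (Z × ℝ≥0)) => (t.2.1, t.1) := by fun_prop
  have hm2 : Measurable fun t : (Y × ℝ≥0) × ((X × ℝ≥0) × (Z × ℝ≥0)) => (t.1, t.2.2) := by fun_prop
  have hq0 : 0 < q := zero_lt_one.trans_le hq
  refine ⟨Γ.map Prod.snd, ⟨inferInstance, fun f hf => ?_, fun f hf => ?_⟩, ?_⟩
  · rw [← hα'.left f hf, ← hΓ1, lintegral_map (by fun_prop) hm1,
      lintegral_map (by fun_prop) measurable_snd]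
  · rw [← hβ''.right f hf, ← hΓ2, lintegral_map (by fun_prop) hm2,
      lintegral_map (by fun_prop) measurable_snd]
  · rw [← hEα, ← (hβ.swap hK).2, ← hEβ, ← hEβ', ← hΓ2, ← hΓ1, hK.energy_map Γ measurable_snd,
      hK.energy_map Γ hm1, hK.energy_map Γ hm2]
    have g1 : Measurable fun v : ((Y × ℝ≥0) × ((X × ℝ≥0) × (Z × ℝ≥0))) ×
        ((Y × ℝ≥0) × ((X × ℝ≥0) × (Z × ℝ≥0))) =>
        pairCost K (v.1.2.1, v.1.1) (v.2.2.1, v.2.1) :=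
      hK.measurable_pairCost.comp ((hm1.comp measurable_fst).prodMk (hm1.comp measurable_snd))
    have g2 : Measurable fun v : ((Y × ℝ≥0) × ((X × ℝ≥0) × (Z × ℝ≥0))) ×
        ((Y × ℝ≥0) × ((X × ℝ≥0) × (Z × ℝ≥0))) =>
        pairCost K (v.1.1, v.1.2.2) (v.2.1, v.2.2.2) :=
      hK.measurable_pairCost.comp ((hm2.comp measurable_fst).prodMk (hm2.comp measurable_snd))
    have g3 : Measurable fun v : ((Y × ℝ≥0) × ((X × ℝ≥0) × (Z × ℝ≥0))) ×
        ((Y × ℝ≥0) × ((X × ℝ≥0) × (Z × ℝ≥0))) => pairCost K v.1.2 v.2.2 :=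
      hK.measurable_pairCost.comp
        ((measurable_snd.comp measurable_fst).prodMk (measurable_snd.comp measurable_snd))
    rw [← lintegral_prod _ g1.aemeasurable, ← lintegral_prod _ g2.aemeasurable,
      ← lintegral_prod _ g3.aemeasurable]
    have hpow : ∀ x : ℝ≥0∞, (x ^ (1 / q)) ^ q = x := fun x => by
      rw [← ENNReal.rpow_mul, one_div, inv_mul_cancel₀ hq0.ne', ENNReal.rpow_one]
    -- Minkowski's inequality for the `q`-th roots of the costs, to which `htri` applies pointwise.
    have hmink := ENNReal.lintegral_Lp_add_le (μ := Γ.prod Γ)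
      (g1.pow_const (1 / q)).aemeasurable (g2.pow_const (1 / q)).aemeasurable hq
    simp only [hpow] at hmink
    refine le_trans ?_ hmink
    refine ENNReal.rpow_le_rpow (lintegral_mono fun v => ?_) (by positivity)
    rw [← hpow (pairCost K v.1.2 v.2.2)]
    exact ENNReal.rpow_le_rpow (htri _ _ _ _ _ _) hq0.le

end Triangle

/-! ### Finiteness, and isometric spaces -/

/-- The plan sends both spaces to the apex. Each pair then has a zero product of weights on some
side, so its cost is independent of the distances and is `0`, `K 0 0 1 0` or `K 0 0 0 1`. -/
theorem IsConeKernel.exists_plan_energy_ne_top {X Y : Type*} [MetricSpace X] [MetricSpace Y]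
    [MeasurableSpace X] [MeasurableSpace Y] [Nonempty X] [Nonempty Y]
    {K : ℝ≥0 → ℝ≥0 → ℝ≥0 → ℝ≥0 → ℝ≥0∞} (hK : IsConeKernel K)
    (hfin : ∀ t u a b, K t u a b ≠ ∞) (μ : Measure X) (ν : Measure Y) [IsFiniteMeasure μ]
    [IsFiniteMeasure ν] : ∃ α, IsLiftedPlan μ ν α ∧ energy K α ≠ ∞ := by
  obtain ⟨x₀⟩ := ‹Nonempty X›
  obtain ⟨y₀⟩ := ‹Nonempty Y›
  have h1 : Measurable fun x : X => ((x, (1 : ℝ≥0)), (y₀, (0 : ℝ≥0))) := by fun_prop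
  have h2 : Measurable fun y : Y => ((x₀, (0 : ℝ≥0)), (y, (1 : ℝ≥0))) := by fun_prop
  set α : Measure ((X × ℝ≥0) × (Y × ℝ≥0)) := μ.map (fun x => ((x, 1), (y₀, 0))) +
    ν.map (fun y => ((x₀, 0), (y, 1))) with hα
  have hαf : IsFiniteMeasure α := by rw [hα]; infer_instance
  refine ⟨α, ⟨hαf, fun f hf => ?_, fun f hf => ?_⟩, ?_⟩
  · rw [hα, lintegral_add_measure, lintegral_map (by fun_prop) h1, lintegral_map (by fun_prop) h2]
    simp
  · rw [hα, lintegral_add_measure, lintegral_map (by fun_prop) h1, lintegral_map (by fun_prop) h2]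
    simp
  · have hae : ∀ᵐ w ∂α, (w.1.2 = 1 ∧ w.2.2 = 0) ∨ (w.1.2 = 0 ∧ w.2.2 = 1) := by
      have hms : MeasurableSet {w : (X × ℝ≥0) × (Y × ℝ≥0) |
          (w.1.2 = 1 ∧ w.2.2 = 0) ∨ (w.1.2 = 0 ∧ w.2.2 = 1)} :=
        ((measurableSet_eq_fun (by fun_prop) (by fun_prop)).inter
          (measurableSet_eq_fun (by fun_prop) (by fun_prop))).union
        ((measurableSet_eq_fun (by fun_prop) (by fun_prop)).inter
          (measurableSet_eq_fun (by fun_prop) (by fun_prop)))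
      rw [hα, ae_add_measure_iff, ae_map_iff h1.aemeasurable hms, ae_map_iff h2.aemeasurable hms]
      simp
    set c : ℝ≥0∞ := K 0 0 1 0 + K 0 0 0 1 with hc
    have hle : energy K α ≤ ∫⁻ _, ∫⁻ _, c ∂α ∂α := by
      refine lintegral_mono_ae ?_
      filter_upwards [hae] with w hw
      refine lintegral_mono_ae ?_
      filter_upwards [hae] with z hz
      have h0 : ∀ t u, K t u 0 0 = 0 := fun t u => (hK.eq_zero_iff _ _ _ _).2 (by simp)
      rcases hw with ⟨a1, b1⟩ | ⟨a1, b1⟩ <;> rcases hz with ⟨a2, b2⟩ | ⟨a2, b2⟩ <;>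
        simp only [pairCost, a1, b1, a2, b2, mul_zero, mul_one, h0, zero_le]
      · rw [hK.apex _ _ 0 0 1 0 (by simp)]
        exact le_self_add
      · rw [hK.apex _ _ 0 0 0 1 (by simp)]
        exact le_add_self
    refine ne_top_of_le_ne_top ?_ hle
    rw [lintegral_const, lintegral_const]
    have := hfin 0 0 1 0
    have := hfin 0 0 0 1
    rw [hc]
    finiteness

/-- The plan is carried by the graph of the isometry with all weights equal to `1`. -/
theorem IsConeKernel.exists_plan_energy_eq_zero {K : ℝ≥0 → ℝ≥0 → ℝ≥0 → ℝ≥0 → ℝ≥0∞}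
    (hK : IsConeKernel K) {X Y : MMSpace.{u}} (h : MMSpace.Isometric X Y) :
    ∃ α, IsLiftedPlan X.meas Y.meas α ∧ energy K α = 0 := by
  obtain ⟨e, he⟩ := h
  have hval : ∀ T : MMSpace.{u}, (T.meas.comap (Subtype.val : T.meas.support → T.carrier)).map
      Subtype.val = T.meas := fun T => by
    rw [map_comap_subtype_coe Measure.isClosed_support.measurableSet]
    exact Measure.restrict_eq_self_of_ae_mem (s := T.meas.support) Measure.support_mem_ae
  have hint : ∀ (T : MMSpace.{u}) (f : T.carrier → ℝ≥0∞), Measurable f →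
      ∫⁻ x, f x.1 ∂(T.meas.comap (Subtype.val : T.meas.support → T.carrier)) =
        ∫⁻ x, f x ∂T.meas := fun T f hf => by
    conv_rhs => rw [← hval T]
    rw [lintegral_map hf measurable_subtype_coe]
  set μ := X.meas.comap (Subtype.val : X.meas.support → X.carrier) with hμ
  have hμf : IsFiniteMeasure μ := by
    refine ⟨?_⟩
    have h1 := congrArg (fun m => m univ) (hval X)
    simp only [Measure.map_apply measurable_subtype_coe MeasurableSet.univ, preimage_univ] at h1
    rw [h1]
    exact measure_lt_top _ _
  have hem : Measurable e := e.continuous.measurable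
  have hF : Measurable fun x : X.meas.support =>
      (((x : X.carrier), (1 : ℝ≥0)), ((e x : Y.carrier), (1 : ℝ≥0))) :=
    (measurable_subtype_coe.prodMk measurable_const).prodMk
      ((measurable_subtype_coe.comp hem).prodMk measurable_const)
  refine ⟨μ.map fun x : X.meas.support => ((x.1, 1), ((e x).1, 1)), ⟨inferInstance, fun f hf => ?_, fun f hf => ?_⟩, ?_⟩
  · rw [lintegral_map (by fun_prop) hF, ← hint X f hf]
    simp [hμ]
  · rw [lintegral_map (by fun_prop) hF, ← hint Y f hf, ← he, lintegral_map (by fun_prop) hem]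
    simp
  · rw [hK.energy_map μ hF]
    have h0 : ∀ w z : X.meas.support, pairCost K (((w : X.carrier), (1 : ℝ≥0)),
        ((e w : Y.carrier), (1 : ℝ≥0))) (((z : X.carrier), (1 : ℝ≥0)),
        ((e z : Y.carrier), (1 : ℝ≥0))) = 0 := fun w z => by
      refine (hK.eq_zero_iff _ _ _ _).2 ⟨rfl, Or.inr ?_⟩
      exact (e.isometry.nndist_eq w z).symm
    simp [h0]

/-! ### The metric -/

/-- A finite symmetric divergence that vanishes exactly on isometric pairs and whose `q`-th root
satisfies the triangle inequality induces a metric on isometry classes. -/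
theorem exists_metricSpace_of_divergence {q : ℝ} (hq : 0 < q) {C : MMSpace.{u} → MMSpace.{u} → ℝ≥0∞}
    (hfin : ∀ X Y, C X Y ≠ ∞) (hsymm : ∀ X Y, C X Y = C Y X)
    (hzero : ∀ X Y, C X Y = 0 ↔ MMSpace.Isometric X Y)
    (htri : ∀ X Y Z, C X Z ^ (1 / q) ≤ C X Y ^ (1 / q) + C Y Z ^ (1 / q)) :
    ∃ m : MetricSpace (Quotient MMSpace.isometricSetoid.{u}), ∀ X Y : MMSpace.{u},
      m.dist (Quotient.mk _ X) (Quotient.mk _ Y) = (C X Y).toReal ^ (1 / q) := by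
  have hq' : 0 < 1 / q := one_div_pos.2 hq
  let d : MMSpace.{u} → MMSpace.{u} → ℝ := fun X Y => (C X Y).toReal ^ (1 / q)
  have hd : ∀ X Y, d X Y = (C X Y ^ (1 / q)).toReal := fun X Y => ENNReal.toReal_rpow _ _
  have hd_tri : ∀ X Y Z, d X Z ≤ d X Y + d Y Z := fun X Y Z => by
    have h : ∀ X Y, C X Y ^ (1 / q) ≠ ∞ := fun X Y =>
      ENNReal.rpow_ne_top_of_nonneg hq'.le (hfin X Y)
    rw [hd, hd, hd, ← ENNReal.toReal_add (h X Y) (h Y Z)]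
    exact ENNReal.toReal_mono (ENNReal.add_ne_top.2 ⟨h X Y, h Y Z⟩) (htri X Y Z)
  have hd_symm : ∀ X Y, d X Y = d Y X := fun X Y => by simp only [d, hsymm X Y]
  have hd_zero : ∀ X Y, MMSpace.Isometric X Y → d X Y = 0 := fun X Y h => by
    simp only [d, (hzero X Y).2 h, ENNReal.toReal_zero]
    exact Real.zero_rpow hq'.ne'
  have hd_eq : ∀ X Y, d X Y = 0 → MMSpace.Isometric X Y := fun X Y h => by
    have h1 := ((Real.rpow_eq_zero_iff_of_nonneg ENNReal.toReal_nonneg).1 h).1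
    exact (hzero X Y).1 ((ENNReal.toReal_eq_zero_iff _).1 h1 |>.resolve_right (hfin X Y))
  -- Invariance under isometry follows from the triangle inequality, since isometric spaces are at
  -- distance `0`.
  have hd_le : ∀ X Y X' Y', MMSpace.Isometric X X' → MMSpace.Isometric Y Y' →
      d X Y ≤ d X' Y' := fun X Y X' Y' hX hY => by
    have h1 := hd_tri X X' Y
    have h2 := hd_tri X' Y' Y
    rw [hd_zero X X' hX] at h1
    rw [hd_symm Y' Y, hd_zero Y Y' hY] at h2
    linarith
  have hsm := MMSpace.isometric_equivalence.{u}
  let D : Quotient MMSpace.isometricSetoid.{u} → Quotient MMSpace.isometricSetoid.{u} → ℝ :=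
    Quotient.lift₂ d fun X Y X' Y' hX hY =>
      le_antisymm (hd_le X Y X' Y' hX hY) (hd_le X' Y' X Y (hsm.symm hX) (hsm.symm hY))
  refine ⟨{ dist := D, dist_self := ?_, dist_comm := ?_, dist_triangle := ?_,
            eq_of_dist_eq_zero := ?_ }, fun X Y => rfl⟩
  · exact fun a => Quotient.inductionOn a fun X => hd_zero X X (hsm.refl X)
  · exact fun a b => Quotient.inductionOn₂ a b fun X Y => hd_symm X Y
  · exact fun a b c => Quotient.inductionOn₃ a b c fun X Y Z => hd_tri X Y Z
  · intro a b
    exact Quotient.inductionOn₂ a b fun X Y h => Quotient.sound (hd_eq X Y h)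

end ConicGW

end

/-! ### The main theorem. -/

theorem mainTheorem1
    (φ lam : ℝ≥0 → ℝ≥0∞) (Δ : ℝ≥0 → ℝ≥0 → ℝ≥0) (p q : ℝ)
    (hφ : ConicGW.IsEntropy φ)
    (hlam : ∀ t, lam t = 0 ↔ t = 0)
    (hΔ : ConicGW.IsDistance (fun t u => (Δ t u : ℝ≥0∞)))
    (hlsc : LowerSemicontinuous (fun z : ℝ≥0 × ℝ≥0 => lam (Δ z.1 z.2)))
    (hp : 0 < p) (hq : 0 < q) :
    (∀ X Y : ConicGW.MMSpace.{u}, 0 ≤ ConicGW.CGW φ lam Δ p q X Y) ∧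
    (∀ X Y : ConicGW.MMSpace.{u},
      ConicGW.CGW φ lam Δ p q X Y = ConicGW.CGW φ lam Δ p q Y X) ∧
    (∀ X Y : ConicGW.MMSpace.{u},
      ConicGW.CGW φ lam Δ p q X Y = 0 ↔ ConicGW.MMSpace.Isometric X Y) ∧
    (1 ≤ q → ConicGW.IsDistance (ConicGW.coneDist φ lam Δ p q) →
      (∀ X Y : ConicGW.MMSpace.{u}, ConicGW.CGW φ lam Δ p q X Y ≠ ∞) ∧
      ∃ m : MetricSpace (Quotient ConicGW.MMSpace.isometricSetoid.{u}),
        ∀ X Y : ConicGW.MMSpace.{u},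
          m.dist (Quotient.mk _ X) (Quotient.mk _ Y) =
            (ConicGW.CGW φ lam Δ p q X Y).toReal ^ (1 / q)) := by
  have hK := ConicGW.isConeKernel_coneKernel hφ hlam hΔ hlsc
  have hD := ConicGW.coneDist_mk_rpow_eq_coneKernel (φ := φ) hlam hΔ hp hq
  have hC := ConicGW.CGW_eq.{u} hK hD hp
  have hsymm_le : ∀ X Y : ConicGW.MMSpace.{u},
      ConicGW.CGW φ lam Δ p q X Y ≤ ConicGW.CGW φ lam Δ p q Y X := fun X Y => by
    rw [hC, hC]
    refine le_iInf₂ fun α hα => ?_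
    obtain ⟨h1, h2⟩ := ConicGW.IsLiftedPlan.swap hK hα
    exact (iInf₂_le _ h1).trans_eq h2
  have hsymm : ∀ X Y : ConicGW.MMSpace.{u},
      ConicGW.CGW φ lam Δ p q X Y = ConicGW.CGW φ lam Δ p q Y X := fun X Y =>
    le_antisymm (hsymm_le X Y) (hsymm_le Y X)
  have hzero : ∀ X Y : ConicGW.MMSpace.{u},
      ConicGW.CGW φ lam Δ p q X Y = 0 ↔ ConicGW.MMSpace.Isometric X Y := fun X Y => by
    rw [hC]
    constructor
    · intro h
      refine hK.isometric fun ε hε => ?_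
      rw [← h] at hε
      simp only [iInf_lt_iff, exists_prop] at hε
      obtain ⟨α, hα, h'⟩ := hε
      exact ⟨α, hα, h'⟩
    · intro h
      obtain ⟨α, hα, h0⟩ := hK.exists_plan_energy_eq_zero h
      exact le_antisymm ((iInf₂_le α hα).trans_eq h0) zero_le
  refine ⟨fun _ _ => zero_le, hsymm, hzero, fun hq1 hdist => ?_⟩
  have hq' : 0 < 1 / q := one_div_pos.2 hq
  -- Undoing `a = r ^ p` carries the finiteness and the triangle inequality of the cone distance
  -- over to the kernel.
  have hroot : ∀ t u a b : ℝ≥0, ConicGW.coneKernel φ lam Δ t u a b ^ (1 / q) =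
      ConicGW.coneDist φ lam Δ p q (ConicGW.Cone.mk t (a ^ p⁻¹))
        (ConicGW.Cone.mk u (b ^ p⁻¹)) := fun t u a b => by
    have h := hD t (a ^ p⁻¹) u (b ^ p⁻¹)
    rw [NNReal.rpow_inv_rpow hp.ne', NNReal.rpow_inv_rpow hp.ne'] at h
    rw [← h, ← ENNReal.rpow_mul, mul_one_div_cancel hq.ne', ENNReal.rpow_one]
  have hKfin : ∀ t u a b : ℝ≥0, ConicGW.coneKernel φ lam Δ t u a b ≠ ∞ := fun t u a b h => by
    have h1 := hdist.ne_top (ConicGW.Cone.mk t (a ^ p⁻¹)) (ConicGW.Cone.mk u (b ^ p⁻¹))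
    rw [← hroot, h, ENNReal.top_rpow_of_pos hq'] at h1
    exact h1 rfl
  have hfin : ∀ X Y : ConicGW.MMSpace.{u}, ConicGW.CGW φ lam Δ p q X Y ≠ ∞ := fun X Y => by
    obtain ⟨α, hα, h⟩ := hK.exists_plan_energy_ne_top hKfin X.meas Y.meas
    rw [hC]
    exact ne_top_of_le_ne_top h (iInf₂_le α hα)
  refine ⟨hfin, ConicGW.exists_metricSpace_of_divergence hq hfin hsymm hzero fun X Y Z => ?_⟩
  have hpow : ∀ X Y : ConicGW.MMSpace.{u}, ConicGW.CGW φ lam Δ p q X Y ^ (1 / q) =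
      ⨅ α ∈ {α | ConicGW.IsLiftedPlan X.meas Y.meas α},
        ConicGW.energy (ConicGW.coneKernel φ lam Δ) α ^ (1 / q) := fun X Y => by
    rw [hC]
    -- The root is an order isomorphism and commutes with the infimum, so the triangle inequality
    -- can be checked plan by plan, without minimizers.
    exact (ENNReal.orderIsoRpow (1 / q) hq').map_iInf₂ _
  rw [hpow, hpow, hpow]
  refine ENNReal.le_iInf₂_add_iInf₂ fun α hα β hβ => ?_
  obtain ⟨γ, hγ, h⟩ := ConicGW.IsLiftedPlan.exists_comp hK hq1
    (fun t u v a b e => by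
      rw [hroot, hroot, hroot]
      exact hdist.triangle _ _ _) hα hβ
  exact (iInf₂_le γ hγ).trans h
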